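/- Let $(\Omega,\mathcal F,\mathsf P)$ be an atomless probability space. A concave distortion is a concave increasing function $\Psi:[0,1]\to[0,1]$ with $\Psi(0)=0$, $\Psi(1)=1$. Let $(\Psi_t)_{t\ge 0}$ be a concave distortion semigroup, i.e. a family of concave distortions, increasing in $t$, with $\Psi_s\circ\Psi_t=\Psi_{s+t}$ for all $s,t\ge 0$; assume that it is not the trivial semigroup $\Psi_t(x)\equiv x$ and that $\Psi_t(0+)=0$ for all $t\ge 0$. Let $G(x)=\lim_{t\downarrow 0}(\Psi_t(x)-x)/t$ for $x\in(0,1)$, and $G(0)=G(1)=0$, be its generator. For a random variable $X$ with distribution function $D_X$, the integral $\int_{\mathbb R}x\,d(\Psi_t(D_X(x)))$ is understood as $\int x^+\,d(\Psi_t(D_X(x)))-\int x^-\,d(\Psi_t(D_X(x)))$, with $\infty-\infty=-\infty$, and likewise $\mathsf E_{\mathsf Q}X=\mathsf E_{\mathsf Q}X^+-\mathsf E_{\mathsf Q}X^-$. Let $L^1(\alpha)$ be the set of random variables $X$ such that, for all $t\ge 0$, $\int_{\mathbb R}x\,d(\Psi_t(D_X(x)))>-\infty$ and $\int_{\mathbb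 R}x\,d(\Psi_t(D_{-X}(x)))>-\infty$. For $t\ge0$ let $\Phi_t(x)=\sup_{y\in[0,1]}[\Psi_t(y)-xy]$, $x\ge 0$, and let $\mathcal D_t$ be the set of probability measures $\mathsf Q\ll\mathsf P$ with $\mathsf E(d\mathsf Q/d\mathsf P-x)^+\le\Phi_t(x)$ for all $x\ge 0$. Then the limit defining $G$ exists and is finite for every $x\in(0,1)$, and for every $X\in L^1(\alpha)$ with a continuous distribution and every $t\ge 0$ the set $\operatorname{argmin}_{\mathsf Q\in\mathcal D_t}\mathsf E_{\mathsf Q}X$ consists of exactly one measure $\mathsf Q^*_t(X)$. Moreover, for every $\varepsilon\in(0,1)$, the following conditions are equivalent: (a) for any $X\in L^1(\alpha)$ with a continuous distribution and any $t>0$, the density $d\mathsf Q_t^*(X)/d\mathsf P$ has $\mathsf P$-essential infimum equal to $0$; (b) for any $t>0$, the left derivative $\partial_x^-\Psi_t(1)$ equals $0$; (c) $\int_{1-\varepsilon}^1\frac{1}{G(s)}\,ds<\infty$ or the left derivative $G'_-(1)$ equals $-\infty$. -/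

import Mathlib

open Set Filter Topology MeasureTheory ProbabilityTheory
open scoped NNReal ENNReal

noncomputable section

/-- A concave distortion: a concave increasing function `[0,1] → [0,1]` with `Ψ 0 = 0`, `Ψ 1 = 1`.
It is represented by a function on `ℝ` of which only the values on `[0,1]` are relevant. -/
structure ConcaveDistortion where
  toFun : ℝ → ℝ
  concave : ConcaveOn ℝ (Icc 0 1) toFun
  mono : MonotoneOn toFun (Icc 0 1)
  map_zero : toFun 0 = 0
  map_one : toFun 1 = 1

instance : CoeFun ConcaveDistortion fun _ => ℝ → ℝ := ⟨ConcaveDistortion.toFun⟩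

/-- A concave distortion semigroup: a family of concave distortions, increasing in `t`, such that
`Ψ_s ∘ Ψ_t = Ψ_{s+t}` on `[0,1]`. -/
structure IsDistortionSemigroup (Ψ : ℝ≥0 → ConcaveDistortion) : Prop where
  mono_time : ∀ x ∈ Icc (0 : ℝ) 1, Monotone fun t => Ψ t x
  comp : ∀ s t : ℝ≥0, ∀ x ∈ Icc (0 : ℝ) 1, Ψ s (Ψ t x) = Ψ (s + t) x

/-- The generator `G(x) = lim_{t ↓ 0} (Ψ_t(x) - x) / t` for `x ∈ (0,1)`, with `G(0) = G(1) = 0`. -/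
def generator (Ψ : ℝ≥0 → ConcaveDistortion) (x : ℝ) : ℝ :=
  open Classical in
  if x ∈ Ioo (0 : ℝ) 1 then limUnder (𝓝[>] (0 : ℝ≥0)) fun t => (Ψ t x - x) / (t : ℝ) else 0

/-- The probability space `(Ω, P)` has no atoms: every event of positive probability contains an
event of strictly smaller positive probability. -/
def IsAtomlessMeasure {Ω : Type*} [MeasurableSpace Ω] (P : Measure Ω) : Prop :=
  ∀ A, MeasurableSet A → 0 < P A → ∃ B, B ⊆ A ∧ MeasurableSet B ∧ 0 < P B ∧ P B < P A

/-- `∫ f dν = ∫ f⁺ dν - ∫ f⁻ dν` as an extended real number, with the convention `∞ - ∞ = -∞`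
(which is the convention for subtraction in `EReal`). -/
def extIntegral {α : Type*} [MeasurableSpace α] (f : α → ℝ) (ν : Measure α) : EReal :=
  ((∫⁻ a, ENNReal.ofReal (f a) ∂ν : ℝ≥0∞) : EReal) -
    ((∫⁻ a, ENNReal.ofReal (-f a) ∂ν : ℝ≥0∞) : EReal)

lemma ConcaveDistortion.monotone_comp_cdf (ψ : ConcaveDistortion) (ν : Measure ℝ) :
    Monotone fun x => ψ (cdf ν x) := fun _ _ h =>
  ψ.mono ⟨cdf_nonneg ν _, cdf_le_one ν _⟩ ⟨cdf_nonneg ν _, cdf_le_one ν _⟩ (monotone_cdf ν h)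

/-- The Lebesgue-Stieltjes measure `d(ψ(D_X(x)))` on `ℝ`, where `D_X` is the distribution function
of `X` under `P`. -/
def distortedLaw {Ω : Type*} [MeasurableSpace Ω] (ψ : ConcaveDistortion) (P : Measure Ω)
    (X : Ω → ℝ) : Measure ℝ :=
  (ψ.monotone_comp_cdf (P.map X)).stieltjesFunction.measure

/-- The distorted expectation `∫_ℝ x d(ψ(D_X(x)))`, with the convention `∞ - ∞ = -∞`. -/
def distortedExpectation {Ω : Type*} [MeasurableSpace Ω] (ψ : ConcaveDistortion) (P : Measure Ω)
    (X : Ω → ℝ) : EReal :=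
  extIntegral (fun x : ℝ => x) (distortedLaw ψ P X)

/-- The space `L¹(α)` of the acceptability index `α` associated with `(Ψ_t)`: the random variables
`X` such that the distorted expectations of `X` and of `-X` are `> -∞` for all `t ≥ 0`. -/
def IndexL1 {Ω : Type*} [MeasurableSpace Ω] (Ψ : ℝ≥0 → ConcaveDistortion) (P : Measure Ω) :
    Set (Ω → ℝ) :=
  {X | Measurable X ∧ ∀ t, ⊥ < distortedExpectation (Ψ t) P X ∧
    ⊥ < distortedExpectation (Ψ t) P (fun ω => -X ω)}

/-- `Φ(x) = sup_{y ∈ [0,1]} (ψ(y) - x y)`. -/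
def ConcaveDistortion.conj (ψ : ConcaveDistortion) (x : ℝ) : ℝ :=
  sSup ((fun y => ψ y - x * y) '' Icc 0 1)

/-- The determining set of the distortion `ψ`: the probability measures `Q ≪ P` such that
`E_P (dQ/dP - x)⁺ ≤ Φ(x)` for all `x ≥ 0`. (Subtraction in `ℝ≥0∞` is the positive part of the
difference.) -/
def determiningSet {Ω : Type*} [MeasurableSpace Ω] (ψ : ConcaveDistortion) (P : Measure Ω) :
    Set (Measure Ω) :=
  {Q | IsProbabilityMeasure Q ∧ Q ≪ P ∧
    ∀ x : ℝ, 0 ≤ x →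
      ∫⁻ ω, (Q.rnDeriv P ω - ENNReal.ofReal x) ∂P ≤ ENNReal.ofReal (ψ.conj x)}

/-- The set of extreme measures `argmin_{Q ∈ D} E_Q X`, where `D` is the determining set
of `ψ`. -/
def extremeMeasures {Ω : Type*} [MeasurableSpace Ω] (ψ : ConcaveDistortion) (P : Measure Ω)
    (X : Ω → ℝ) : Set (Measure Ω) :=
  {Q | Q ∈ determiningSet ψ P ∧ ∀ Q' ∈ determiningSet ψ P, extIntegral X Q ≤ extIntegral X Q'}

end

/-! Extreme measures. If `X` has a continuous distribution function `D`, then `D(X)` is uniform, and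
the measure with density `Ψ_t'(D(X))` gives `X` the distribution function `Ψ_t ∘ D`. Fenchel duality
yields `Q(A) ≤ Ψ_t(P(A))` for every `Q` in the determining set
(`measureReal_le_of_mem_determiningSet`), so `X` is stochastically smallest under that measure,
which is therefore a minimiser. Any other minimiser gives `X` the same finite mean, hence the same
distribution function, and equality in the duality bound on all sets `{X ≤ c}` forces the density
(`rnDeriv_ae_eq_of_measure_le_eq`). The essential infimum of `Ψ_t'(U)`, `U` uniform, is the limit of
`Ψ_t'` at `1`, that is, the left derivative there. This gives (a) ⇔ (b), once atomlessness has
supplied some admissible `X`.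

Semigroup. Concavity makes the difference quotients at time `0` almost monotone, so `G` exists; it
is concave, and the orbits `s ↦ Ψ_s(x)` solve `u' = G(u)` from the right. If `∫ 1/G` converges at
`1`, orbits starting near `1` reach `1` before time `t`, so `Ψ_t = 1` near `1`. Otherwise compare
with the linear equation: `G(z) ≥ K(1-z)` near `1` gives `1 - Ψ_t(y) ≤ e^{-Kt}(1-y)`, and the
reverse bound on `G` gives the reverse inequality. So `Ψ_t` has zero left derivative at `1` exactly
when `G(z)/(1-z)` is unbounded there. -/

noncomputable section

/-! ### Concave distortions: right derivative, conjugate, chords to the point `1`. -/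

namespace ConcaveDistortion

variable (ψ : ConcaveDistortion)

lemma nonneg {x : ℝ} (hx : x ∈ Icc (0 : ℝ) 1) : 0 ≤ ψ x := by
  have := ψ.mono (left_mem_Icc.2 zero_le_one) hx hx.1
  rwa [ψ.map_zero] at this

lemma le_one {x : ℝ} (hx : x ∈ Icc (0 : ℝ) 1) : ψ x ≤ 1 := by
  have := ψ.mono hx (right_mem_Icc.2 zero_le_one) hx.2
  rwa [ψ.map_one] at this

lemma mem_Icc {x : ℝ} (hx : x ∈ Icc (0 : ℝ) 1) : ψ x ∈ Icc (0 : ℝ) 1 :=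
  ⟨ψ.nonneg hx, ψ.le_one hx⟩

lemma le_apply {x : ℝ} (hx : x ∈ Icc (0 : ℝ) 1) : x ≤ ψ x := by
  have := ψ.concave.2 (left_mem_Icc.2 zero_le_one) (right_mem_Icc.2 zero_le_one)
    (sub_nonneg.2 hx.2) hx.1 (by ring)
  simpa [ψ.map_zero, ψ.map_one] using this

lemma continuousOn (hψ : Tendsto ψ (𝓝[>] 0) (𝓝 0)) : ContinuousOn ψ (Icc 0 1) := by
  have hint : ContinuousOn ψ (Ioo 0 1) := by
    simpa [interior_Icc] using ψ.concave.continuousOn_interior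
  intro x hx
  rcases hx.1.eq_or_lt with rfl | h0
  · have : ContinuousWithinAt ψ (Ioi 0) 0 := by
      simpa [ContinuousWithinAt, ψ.map_zero] using hψ
    exact (continuousWithinAt_Ioi_iff_Ici.1 this).mono Icc_subset_Ici_self
  rcases hx.2.eq_or_lt with rfl | h1
  · rw [ContinuousWithinAt, ψ.map_one]
    refine tendsto_of_tendsto_of_tendsto_of_le_of_le' (g := fun x => x) (h := fun _ => 1)
      (tendsto_nhdsWithin_of_tendsto_nhds tendsto_id) tendsto_const_nhds ?_ ?_
    all_goals
      filter_upwards [self_mem_nhdsWithin] with x hx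
    · exact ψ.le_apply hx
    · exact ψ.le_one hx
  · exact (hint.continuousAt (Ioo_mem_nhds h0 h1)).continuousWithinAt

/-- The right derivative of a concave distortion on `(0,1)`, extended by `0`. -/
def density (u : ℝ) : ℝ :=
  (Ioo (0 : ℝ) 1).indicator (fun u => -derivWithin (fun y => -ψ y) (Ioi u) u) u

lemma density_of_mem {u : ℝ} (hu : u ∈ Ioo (0 : ℝ) 1) :
    ψ.density u = -derivWithin (fun y => -ψ y) (Ioi u) u := by
  simp only [density, indicator_of_mem hu]

lemma measurable_density : Measurable ψ.density :=
  (measurable_derivWithin_Ioi _).neg.indicator measurableSet_Ioo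

lemma convexOn_neg : ConvexOn ℝ (Icc 0 1) fun y => -ψ y := ψ.concave.neg

lemma hasDerivWithinAt_density {u : ℝ} (hu : u ∈ Ioo (0 : ℝ) 1) :
    HasDerivWithinAt ψ (ψ.density u) (Ioi u) u := by
  have := (ψ.convexOn_neg.hasDerivWithinAt_rightDeriv_of_mem_interior
    (by simpa [interior_Icc] using hu)).neg
  rw [density_of_mem ψ hu]
  exact this.congr_of_eventuallyEq (Eventually.of_forall fun y => (neg_neg _).symm)
    (neg_neg _).symm

/-- The right derivative is a supergradient. Nearly every later use of concavity in terms of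
`density` goes through this inequality. -/
lemma apply_le_density {p y : ℝ} (hp : p ∈ Ioo (0 : ℝ) 1) (hy : y ∈ Icc (0 : ℝ) 1) :
    ψ y ≤ ψ p + ψ.density p * (y - p) := by
  have hpi : p ∈ interior (Icc (0 : ℝ) 1) := by simpa [interior_Icc] using hp
  have hpI : p ∈ Icc (0 : ℝ) 1 := ⟨hp.1.le, hp.2.le⟩
  rw [density_of_mem ψ hp]
  rcases lt_trichotomy y p with h | rfl | h
  · have h1 := (ψ.convexOn_neg.slope_le_leftDeriv_of_mem_interior hy hpi h).trans
      (ψ.convexOn_neg.leftDeriv_le_rightDeriv_of_mem_interior hpi)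
    rw [slope_def_field, div_le_iff₀ (sub_pos.2 h)] at h1
    linarith
  · simp
  · have h1 := ψ.convexOn_neg.rightDeriv_le_slope_of_mem_interior hpi hy h
    rw [slope_def_field, le_div_iff₀ (sub_pos.2 h)] at h1
    linarith

lemma density_nonneg (u : ℝ) : 0 ≤ ψ.density u := by
  by_cases hu : u ∈ Ioo (0 : ℝ) 1
  · have h1 := ψ.apply_le_density hu (right_mem_Icc.2 zero_le_one)
    have h2 := ψ.le_one (x := u) ⟨hu.1.le, hu.2.le⟩
    rw [ψ.map_one] at h1
    have h3 : 0 < 1 - u := by linarith [hu.2]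
    by_contra! h
    nlinarith
  · simp [density, hu]

lemma antitoneOn_density : AntitoneOn ψ.density (Ioo 0 1) := by
  intro u hu v hv huv
  rcases huv.eq_or_lt with rfl | h
  · exact le_rfl
  have h1 := ψ.apply_le_density hu (y := v) ⟨hv.1.le, hv.2.le⟩
  have h2 := ψ.apply_le_density hv (y := u) ⟨hu.1.le, hu.2.le⟩
  nlinarith

/-- Fundamental theorem of calculus for the right derivative. The condition `hψ` excludes a jump at
`0`, which the density would miss. -/
lemma setLIntegral_density (hψ : Tendsto ψ (𝓝[>] 0) (𝓝 0)) {p : ℝ} (hp : p ∈ Icc (0 : ℝ) 1) :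
    ∫⁻ u in Ioc 0 p, ENNReal.ofReal (ψ.density u) = ENNReal.ofReal (ψ p) := by
  have hc : ContinuousOn ψ (Icc 0 p) := (ψ.continuousOn hψ).mono (Icc_subset_Icc_right hp.2)
  have hd : ∀ x ∈ Ioo 0 p, HasDerivWithinAt ψ (ψ.density x) (Ioi x) x := fun x hx =>
    ψ.hasDerivWithinAt_density ⟨hx.1, hx.2.trans_le hp.2⟩
  have hi := intervalIntegral.integrableOn_deriv_right_of_nonneg hc hd
    fun x _ => ψ.density_nonneg x
  have := intervalIntegral.integral_eq_sub_of_hasDeriv_right_of_le hp.1 hc hd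
    ((intervalIntegrable_iff_integrableOn_Ioc_of_le hp.1).2 hi)
  rw [ψ.map_zero, sub_zero, intervalIntegral.integral_of_le hp.1] at this
  rw [← this, ofReal_integral_eq_lintegral_ofReal hi (ae_of_all _ ψ.density_nonneg)]

lemma bddAbove_conj {x : ℝ} (hx : 0 ≤ x) : BddAbove ((fun y => ψ y - x * y) '' Icc 0 1) := by
  refine ⟨1, ?_⟩
  rintro _ ⟨y, hy, rfl⟩
  have := ψ.le_one hy
  have := mul_nonneg hx hy.1
  simp only
  linarith

lemma le_conj {x y : ℝ} (hx : 0 ≤ x) (hy : y ∈ Icc (0 : ℝ) 1) : ψ y - x * y ≤ ψ.conj x :=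
  le_csSup (ψ.bddAbove_conj hx) ⟨y, hy, rfl⟩

lemma conj_density_le {p : ℝ} (hp : p ∈ Ioo (0 : ℝ) 1) :
    ψ.conj (ψ.density p) ≤ ψ p - ψ.density p * p := by
  refine csSup_le ((nonempty_Icc.2 zero_le_one).image _) ?_
  rintro _ ⟨y, hy, rfl⟩
  have := ψ.apply_le_density hp hy
  simp only
  linarith

/-- The density decreases, so it exceeds `x` on an initial interval, of length `p` say. The integral
is then `ψ p - x * p`, one of the competitors in the supremum defining the conjugate. -/
lemma lintegral_density_sub_le (hψ : Tendsto ψ (𝓝[>] 0) (𝓝 0)) {x : ℝ} (hx : 0 ≤ x) :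
    ∫⁻ u in Ioo 0 1, (ENNReal.ofReal (ψ.density u) - ENNReal.ofReal x) ≤
      ENNReal.ofReal (ψ.conj x) := by
  set S : Set ℝ := {u ∈ Ioo 0 1 | x < ψ.density u} with hS
  obtain ⟨p, hp, hlow, hupp⟩ : ∃ p ∈ Icc (0 : ℝ) 1, Ioo 0 p ⊆ S ∧ S ⊆ Ioc 0 p := by
    rcases S.eq_empty_or_nonempty with h | ⟨a, ha⟩
    · exact ⟨0, by simp, by simp, by simp [h]⟩
    have hbd : BddAbove S := ⟨1, fun u hu => hu.1.2.le⟩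
    refine ⟨sSup S, ⟨ha.1.1.le.trans (le_csSup hbd ha), csSup_le ⟨a, ha⟩ fun u hu => hu.1.2.le⟩,
      fun u hu => ?_, fun u hu => ⟨hu.1.1, le_csSup hbd hu⟩⟩
    obtain ⟨v, hv, huv⟩ := exists_lt_of_lt_csSup ⟨a, ha⟩ hu.2
    have hu' : u ∈ Ioo (0 : ℝ) 1 := ⟨hu.1, huv.trans hv.1.2⟩
    exact ⟨hu', hv.2.trans_le (ψ.antitoneOn_density hu' hv.1 huv.le)⟩
  calc ∫⁻ u in Ioo 0 1, (ENNReal.ofReal (ψ.density u) - ENNReal.ofReal x)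
      ≤ ∫⁻ u in Ioc 0 p, (ENNReal.ofReal (ψ.density u) - ENNReal.ofReal x) := by
        rw [← lintegral_indicator measurableSet_Ioo, ← lintegral_indicator measurableSet_Ioc]
        refine lintegral_mono fun u => ?_
        by_cases hu : u ∈ S
        · simp [hupp hu, hu.1]
        · by_cases hu1 : u ∈ Ioo (0 : ℝ) 1
          · have : ψ.density u ≤ x := not_lt.1 fun h => hu ⟨hu1, h⟩
            simp [hu1, tsub_eq_zero_of_le (ENNReal.ofReal_le_ofReal this)]
          · simp [hu1]
    _ = ENNReal.ofReal (ψ p) - ENNReal.ofReal (x * p) := by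
        rw [lintegral_sub measurable_const, ψ.setLIntegral_density hψ hp]
        · simp [ENNReal.ofReal_mul hx]
        · simp [ENNReal.mul_eq_top]
        · rw [← restrict_Ioo_eq_restrict_Ioc]
          filter_upwards [ae_restrict_mem measurableSet_Ioo] with u hu
          exact ENNReal.ofReal_le_ofReal (hlow hu).2.le
    _ ≤ ENNReal.ofReal (ψ.conj x) := by
        rw [← ENNReal.ofReal_sub _ (mul_nonneg hx hp.1)]
        exact ENNReal.ofReal_le_ofReal (ψ.le_conj hx hp)

/-- Concavity on `y ≤ z ≤ 1`: the slopes of the chords to the point `(1, 1)` decrease, here cleared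
of denominators. -/
lemma slope_one_antitone {y z : ℝ} (hy : 0 ≤ y) (hyz : y ≤ z) (hz : z < 1) :
    (1 - ψ z) * (1 - y) ≤ (1 - ψ y) * (1 - z) := by
  have h1y : 0 < 1 - y := by linarith
  have hya : y ∈ Icc (0 : ℝ) 1 := ⟨hy, by linarith⟩
  have ha : 0 ≤ (1 - z) / (1 - y) := div_nonneg (by linarith) h1y.le
  have hb : 0 ≤ (z - y) / (1 - y) := div_nonneg (by linarith) h1y.le
  have := ψ.concave.2 hya (right_mem_Icc.2 zero_le_one) ha hb (by field_simp; ring)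
  rw [ψ.map_one] at this
  have e : (1 - z) / (1 - y) * y + (z - y) / (1 - y) * 1 = z := by field_simp; ring
  simp only [smul_eq_mul] at this
  rw [e, div_mul_eq_mul_div, div_mul_eq_mul_div, ← add_div, div_le_iff₀ h1y] at this
  linarith

/-- The left derivative of a concave distortion at `1` vanishes iff the slopes of its chords to
the point `1` are arbitrarily small. -/
lemma hasDerivWithinAt_zero_iff :
    HasDerivWithinAt ψ 0 (Iic 1) 1 ↔
      ∀ c > 0, ∃ y ∈ Ioo (0 : ℝ) 1, 1 - ψ y < c * (1 - y) := by
  rw [← hasDerivWithinAt_Iio_iff_Iic, hasDerivWithinAt_iff_tendsto_slope' (by simp)]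
  have hs : ∀ y < 1, slope ψ 1 y = (1 - ψ y) / (1 - y) := fun y hy => by
    rw [slope_def_field, ψ.map_one, ← neg_sub 1, ← neg_sub 1 y, neg_div_neg_eq]
  constructor
  · intro h c hc
    obtain ⟨y, h1, h2⟩ := ((h.eventually (gt_mem_nhds hc)).and
      (Ioo_mem_nhdsLT (zero_lt_one' ℝ))).exists
    refine ⟨y, h2, ?_⟩
    rwa [hs y h2.2, div_lt_iff₀ (by linarith [h2.2])] at h1
  · intro h
    rw [Metric.tendsto_nhds]
    intro c hc
    obtain ⟨y, hy, hyc⟩ := h c hc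
    filter_upwards [Ioo_mem_nhdsLT hy.2] with z hz
    have hz1 : 0 < 1 - z := by linarith [hz.2]
    have h0 : 0 ≤ 1 - ψ z := by linarith [ψ.le_one (x := z) ⟨(hy.1.trans hz.1).le, hz.2.le⟩]
    rw [hs z hz.2, Real.dist_0_eq_abs, abs_of_nonneg (by positivity), div_lt_iff₀ hz1]
    have := ψ.slope_one_antitone hy.1.le hz.1.le hz.2
    have h1y : 0 < 1 - y := by linarith [hy.2]
    by_contra! hcon
    nlinarith

end ConcaveDistortion

/-! ### The probability integral transform. -/

section UniformTransform

variable {Ω : Type*} [MeasurableSpace Ω] {P : Measure Ω} [IsProbabilityMeasure P] {X : Ω → ℝ}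

lemma cdf_map_eq_real (hX : Measurable X) (c : ℝ) : cdf (P.map X) c = P.real {ω | X ω ≤ c} := by
  have : IsProbabilityMeasure (P.map X) := Measure.isProbabilityMeasure_map hX.aemeasurable
  rw [cdf_eq_real, map_measureReal_apply hX measurableSet_Iic]
  rfl

lemma measure_le_eq_cdf (hX : Measurable X) (c : ℝ) :
    P {ω | X ω ≤ c} = ENNReal.ofReal (cdf (P.map X) c) := by
  rw [cdf_map_eq_real hX, ofReal_measureReal]

lemma exists_cdf_eq {μ : Measure ℝ} (hc : Continuous (cdf μ)) {p : ℝ} (hp : p ∈ Ioo (0 : ℝ) 1) :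
    ∃ c, cdf μ c = p :=
  mem_range_of_exists_le_of_exists_ge hc
    (((tendsto_cdf_atBot μ).eventually (gt_mem_nhds hp.1)).exists.imp fun _ h => h.le)
    (((tendsto_cdf_atTop μ).eventually (lt_mem_nhds hp.2)).exists.imp fun _ h => h.le)

lemma measurable_cdf_comp {μ : Measure ℝ} (hX : Measurable X) : Measurable fun ω => cdf μ (X ω) :=
  (monotone_cdf μ).measurable.comp hX

/-- The distribution function of a random variable with a continuous distribution transforms
this random variable into a uniform one. -/
lemma map_cdf_comp_eq (hX : Measurable X) (hc : Continuous (cdf (P.map X))) :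
    P.map (fun ω => cdf (P.map X) (X ω)) = volume.restrict (Ioc 0 1) := by
  set D := cdf (P.map X) with hD
  -- Taking `p > a` makes the quantile `c` of `p` lie beyond `{D(X) ≤ a}` whatever the plateaus of
  -- `D`. Letting `p` decrease to `a` also covers `a = 0`, which `D` need not attain.
  have hupp : ∀ a p : ℝ, p ∈ Ioo (0 : ℝ) 1 → a < p → P {ω | D (X ω) ≤ a} ≤ ENNReal.ofReal p := by
    intro a p hp hap
    obtain ⟨c, hcp⟩ := exists_cdf_eq hc hp
    rw [← hcp, ← measure_le_eq_cdf hX]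
    refine measure_mono fun ω hω => ?_
    by_contra! h
    have := monotone_cdf (P.map X) (not_le.1 h).le
    simp only [mem_ofPred_eq] at hω
    linarith
  have : IsProbabilityMeasure (P.map fun ω => D (X ω)) :=
    Measure.isProbabilityMeasure_map (measurable_cdf_comp hX).aemeasurable
  refine Measure.ext_of_Iic _ _ fun a => ?_
  rw [Measure.map_apply (measurable_cdf_comp hX) measurableSet_Iic,
    Measure.restrict_apply measurableSet_Iic]
  change P {ω | D (X ω) ≤ a} = _
  rcases le_or_gt a 0 with h0 | h0
  · have e : Iic a ∩ Ioc (0 : ℝ) 1 = ∅ := by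
      ext u; simp only [mem_inter_iff, mem_Iic, mem_Ioc, mem_empty_iff_false, iff_false]
      intro h; linarith [h.1, h.2.1]
    rw [e, measure_empty]
    refine le_antisymm (ge_of_tendsto (f := fun p : ℝ => ENNReal.ofReal p) (x := 𝓝[>] 0) ?_ ?_)
      bot_le
    · rw [← ENNReal.ofReal_zero]
      exact ENNReal.tendsto_ofReal (tendsto_nhdsWithin_of_tendsto_nhds tendsto_id)
    · filter_upwards [Ioo_mem_nhdsGT (zero_lt_one' ℝ)] with p hp
      exact hupp a p hp (h0.trans_lt hp.1)
  rcases le_or_gt 1 a with h1 | h1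
  · have e : {ω | D (X ω) ≤ a} = univ := eq_univ_of_forall fun ω => (cdf_le_one _ _).trans h1
    have e' : Iic a ∩ Ioc (0 : ℝ) 1 = Ioc 0 1 :=
      inter_eq_right.2 fun u hu => hu.2.trans h1
    rw [e, e', measure_univ]
    simp
  · have e : Iic a ∩ Ioc (0 : ℝ) 1 = Ioc 0 a := by
      ext u; simp only [mem_inter_iff, mem_Iic, mem_Ioc]
      exact ⟨fun h => ⟨h.2.1, h.1⟩, fun h => ⟨h.2, h.1, h.2.trans h1.le⟩⟩
    rw [e, Real.volume_Ioc, sub_zero]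
    refine le_antisymm (ge_of_tendsto (f := fun p : ℝ => ENNReal.ofReal p) (x := 𝓝[>] a) ?_ ?_) ?_
    · exact ENNReal.tendsto_ofReal (tendsto_nhdsWithin_of_tendsto_nhds tendsto_id)
    · filter_upwards [Ioo_mem_nhdsGT h1] with p hp
      exact hupp a p ⟨h0.trans hp.1, hp.2⟩ hp.1
    · obtain ⟨c, hca⟩ := exists_cdf_eq hc ⟨h0, h1⟩
      rw [← hca, ← measure_le_eq_cdf hX]
      exact measure_mono fun ω hω => monotone_cdf _ hω

lemma ae_cdf_mem_Ioo (hX : Measurable X) (hc : Continuous (cdf (P.map X))) :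
    ∀ᵐ ω ∂P, cdf (P.map X) (X ω) ∈ Ioo (0 : ℝ) 1 := by
  have : ∀ᵐ u ∂(P.map fun ω => cdf (P.map X) (X ω)), u ∈ Ioo (0 : ℝ) 1 := by
    rw [map_cdf_comp_eq hX hc, ← restrict_Ioo_eq_restrict_Ioc]
    exact ae_restrict_mem measurableSet_Ioo
  exact ae_of_ae_map (measurable_cdf_comp hX).aemeasurable this

/-- The right-hand set is larger by a plateau of `D` only, and uniformity of `D(X)` shows that both
sets have probability `D(c)`. -/
lemma setOf_le_ae_eq_cdf_le (hX : Measurable X) (hc : Continuous (cdf (P.map X))) (c : ℝ) :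
    ({ω | X ω ≤ c} : Set Ω) =ᵐ[P] {ω | cdf (P.map X) (X ω) ≤ cdf (P.map X) c} := by
  have hm : MeasurableSet {ω | X ω ≤ c} := measurableSet_le hX measurable_const
  refine ae_eq_of_subset_of_measure_ge (fun ω hω => monotone_cdf _ hω) ?_ hm.nullMeasurableSet
    (measure_ne_top _ _)
  have h := congrArg (fun μ => μ (Iic (cdf (P.map X) c))) (map_cdf_comp_eq hX hc)
  simp only [Measure.map_apply (measurable_cdf_comp hX) measurableSet_Iic,
    Measure.restrict_apply measurableSet_Iic] at h
  change P {ω | cdf (P.map X) (X ω) ≤ cdf (P.map X) c} = _ at h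
  rw [h, measure_le_eq_cdf hX]
  calc volume (Iic (cdf (P.map X) c) ∩ Ioc 0 1) ≤ volume (Ioc 0 (cdf (P.map X) c)) :=
        measure_mono fun u hu => ⟨hu.2.1, hu.1⟩
    _ = _ := by rw [Real.volume_Ioc, sub_zero]

end UniformTransform

/-! ### Stochastic order and means, via the layer-cake formula. -/

section StochasticOrder

variable {Ω : Type*} [MeasurableSpace Ω] {X : Ω → ℝ}

lemma lintegral_ofReal_eq_lintegral_lt (μ : Measure Ω) (hX : Measurable X) :
    ∫⁻ ω, ENNReal.ofReal (X ω) ∂μ = ∫⁻ t in Ioi (0 : ℝ), μ {ω | t < X ω} := by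
  have h := lintegral_eq_lintegral_meas_lt (f := fun ω => max (X ω) 0) μ
    (ae_of_all _ fun ω => le_max_right _ _) (hX.max measurable_const).aemeasurable
  simp only [ENNReal.ofReal_max, ENNReal.ofReal_zero, max_zero] at h
  rw [h]
  refine setLIntegral_congr_fun measurableSet_Ioi fun t ht => ?_
  congr 1
  ext ω
  simp [not_lt.2 (le_of_lt (mem_Ioi.1 ht))]

lemma lintegral_ofReal_neg_eq_lintegral_le (μ : Measure Ω) (hX : Measurable X) :
    ∫⁻ ω, ENNReal.ofReal (-X ω) ∂μ = ∫⁻ t in Ioi (0 : ℝ), μ {ω | X ω ≤ -t} := by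
  have h := lintegral_eq_lintegral_meas_le (f := fun ω => max (-X ω) 0) μ
    (ae_of_all _ fun ω => le_max_right _ _) (hX.neg.max measurable_const).aemeasurable
  simp only [ENNReal.ofReal_max, ENNReal.ofReal_zero, max_zero] at h
  rw [h]
  refine setLIntegral_congr_fun measurableSet_Ioi fun t ht => ?_
  congr 1
  ext ω
  simp [not_le.2 (mem_Ioi.1 ht), le_neg]

variable {μ ν : Measure Ω}

lemma lintegral_ofReal_neg_le_of_measure_le_le (hX : Measurable X)
    (h : ∀ c, μ {ω | X ω ≤ c} ≤ ν {ω | X ω ≤ c}) :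
    ∫⁻ ω, ENNReal.ofReal (-X ω) ∂μ ≤ ∫⁻ ω, ENNReal.ofReal (-X ω) ∂ν := by
  rw [lintegral_ofReal_neg_eq_lintegral_le _ hX, lintegral_ofReal_neg_eq_lintegral_le _ hX]
  exact lintegral_mono fun t => h _

variable [IsProbabilityMeasure μ] [IsProbabilityMeasure ν]

lemma measure_lt_le_of_measure_le_le (hX : Measurable X)
    (h : ∀ c, μ {ω | X ω ≤ c} ≤ ν {ω | X ω ≤ c}) (c : ℝ) :
    ν {ω | c < X ω} ≤ μ {ω | c < X ω} := by
  have hm : MeasurableSet {ω | X ω ≤ c} := measurableSet_le hX measurable_const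
  have e : {ω | c < X ω} = {ω | X ω ≤ c}ᶜ := by ext; simp
  rw [e, prob_compl_eq_one_sub hm, prob_compl_eq_one_sub hm]
  exact tsub_le_tsub_left (h c) 1

lemma lintegral_ofReal_le_of_measure_le_le (hX : Measurable X)
    (h : ∀ c, μ {ω | X ω ≤ c} ≤ ν {ω | X ω ≤ c}) :
    ∫⁻ ω, ENNReal.ofReal (X ω) ∂ν ≤ ∫⁻ ω, ENNReal.ofReal (X ω) ∂μ := by
  rw [lintegral_ofReal_eq_lintegral_lt _ hX, lintegral_ofReal_eq_lintegral_lt _ hX]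
  exact lintegral_mono fun t => measure_lt_le_of_measure_le_le hX h t

lemma extIntegral_le_of_measure_le_le (hX : Measurable X)
    (h : ∀ c, μ {ω | X ω ≤ c} ≤ ν {ω | X ω ≤ c}) : extIntegral X ν ≤ extIntegral X μ :=
  EReal.sub_le_sub (by exact_mod_cast lintegral_ofReal_le_of_measure_le_le hX h)
    (by exact_mod_cast lintegral_ofReal_neg_le_of_measure_le_le hX h)

/-- If `X` is stochastically larger under `μ` than under `ν` and has the same finite mean under
both measures, then it has the same distribution function under both measures. -/
lemma measure_le_eq_of_extIntegral_le (hX : Measurable X)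
    (h : ∀ c, μ {ω | X ω ≤ c} ≤ ν {ω | X ω ≤ c})
    (hpos : ∫⁻ ω, ENNReal.ofReal (X ω) ∂ν ≠ ∞) (hneg : ∫⁻ ω, ENNReal.ofReal (-X ω) ∂ν ≠ ∞)
    (hle : extIntegral X μ ≤ extIntegral X ν) (c : ℝ) :
    μ {ω | X ω ≤ c} = ν {ω | X ω ≤ c} := by
  have hp := lintegral_ofReal_le_of_measure_le_le hX h
  have hn := lintegral_ofReal_neg_le_of_measure_le_le hX h
  -- All four integrals turn out to be finite, so the comparison of means takes place in `ℝ`, and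
  -- the one-sided inequalities `hp` and `hn` can only be equalities.
  obtain ⟨hp', hn'⟩ : ∫⁻ ω, ENNReal.ofReal (X ω) ∂μ ≤ ∫⁻ ω, ENNReal.ofReal (X ω) ∂ν ∧
      ∫⁻ ω, ENNReal.ofReal (-X ω) ∂ν ≤ ∫⁻ ω, ENNReal.ofReal (-X ω) ∂μ := by
    unfold extIntegral at hle
    generalize ∫⁻ ω, ENNReal.ofReal (X ω) ∂μ = a' at *
    generalize ∫⁻ ω, ENNReal.ofReal (X ω) ∂ν = a at *
    generalize ∫⁻ ω, ENNReal.ofReal (-X ω) ∂μ = b' at *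
    generalize ∫⁻ ω, ENNReal.ofReal (-X ω) ∂ν = b at *
    lift a to ℝ≥0 using hpos
    lift b to ℝ≥0 using hneg
    lift b' to ℝ≥0 using ne_top_of_le_ne_top ENNReal.coe_ne_top hn
    have ha' : a' ≠ ∞ := by
      rintro rfl
      rw [EReal.coe_ennreal_top, EReal.coe_nnreal_eq_coe_real b',
        EReal.coe_nnreal_eq_coe_real a, EReal.coe_nnreal_eq_coe_real b, EReal.top_sub_coe,
        ← EReal.coe_sub] at hle
      exact EReal.coe_ne_top _ (top_le_iff.1 hle)
    lift a' to ℝ≥0 using ha'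
    simp only [EReal.coe_nnreal_eq_coe_real, ← EReal.coe_sub, EReal.coe_le_coe_iff] at hle
    norm_cast at hp hn ⊢
    rw [← NNReal.coe_le_coe] at hp hn ⊢
    rw [← NNReal.coe_le_coe]
    constructor <;> linarith
  rw [lintegral_ofReal_eq_lintegral_lt _ hX, lintegral_ofReal_eq_lintegral_lt _ hX] at hp'
  rw [lintegral_ofReal_neg_eq_lintegral_le _ hX, lintegral_ofReal_neg_eq_lintegral_le _ hX] at hn'
  rw [lintegral_ofReal_eq_lintegral_lt _ hX] at hpos
  rw [lintegral_ofReal_neg_eq_lintegral_le _ hX] at hneg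
  have hmle : ∀ c, MeasurableSet {ω | X ω ≤ c} := fun c => measurableSet_le hX measurable_const
  have hcompl : ∀ c, {ω | X ω ≤ c} = {ω | c < X ω}ᶜ := fun c => by ext; simp
  have h1 : ∀ᵐ t ∂(volume.restrict (Ioi (0 : ℝ))), μ {ω | X ω ≤ t} = ν {ω | X ω ≤ t} := by
    have hanti : Antitone fun t => μ {ω | t < X ω} := fun s t hst =>
      measure_mono fun ω (hω : t < X ω) => hst.trans_lt hω
    filter_upwards [ae_eq_of_ae_le_of_lintegral_le
      (ae_of_all _ (measure_lt_le_of_measure_le_le hX h)) hpos hanti.measurable.aemeasurable hp']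
      with t ht
    rw [hcompl, prob_compl_eq_one_sub (measurableSet_lt measurable_const hX),
      prob_compl_eq_one_sub (measurableSet_lt measurable_const hX), ht]
  have h2 : ∀ᵐ t ∂(volume.restrict (Ioi (0 : ℝ))), μ {ω | X ω ≤ -t} = ν {ω | X ω ≤ -t} := by
    have hanti : Antitone fun t => ν {ω | X ω ≤ -t} := fun s t hst =>
      measure_mono fun ω (hω : X ω ≤ -t) => hω.trans (neg_le_neg hst)
    exact ae_eq_of_ae_le_of_lintegral_le (ae_of_all _ fun t => h (-t))
      (ne_top_of_le_ne_top hneg (lintegral_mono fun t => h (-t))) hanti.measurable.aemeasurable hn'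
  -- The distribution functions agree almost everywhere. If they differed at `c`, right continuity
  -- of the smaller one would keep them apart on an interval `(c, d)`.
  by_contra hne
  have hlt := lt_of_le_of_ne (h c) hne
  have htend : Tendsto (fun t => μ {ω | X ω ≤ t}) (𝓝[>] c) (𝓝 (μ {ω | X ω ≤ c})) := by
    have e : {ω | X ω ≤ c} = ⋂ r > c, {ω | X ω ≤ r} := by
      ext ω
      simp only [mem_ofPred_eq, gt_iff_lt, mem_iInter]
      exact ⟨fun h r hr => h.trans hr.le, fun h => le_of_forall_gt_imp_ge_of_dense h⟩
    rw [e]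
    exact tendsto_measure_biInter_gt (fun r _ => (hmle r).nullMeasurableSet)
      (fun i j _ hij ω (hω : X ω ≤ i) => hω.trans hij) ⟨c + 1, by simp, measure_ne_top _ _⟩
  obtain ⟨d, hd, hdlt⟩ := (mem_nhdsGT_iff_exists_Ioo_subset).1
    (htend.eventually (gt_mem_nhds hlt))
  have hd' : ∀ t ∈ Ioo c d, μ {ω | X ω ≤ t} ≠ ν {ω | X ω ≤ t} := fun t ht =>
    ((hdlt ht).trans_le (measure_mono fun ω (hω : X ω ≤ c) => hω.trans ht.1.le)).ne
  rcases le_or_gt 0 c with h0 | h0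
  · rw [ae_restrict_iff' measurableSet_Ioi] at h1
    rw [ae_iff] at h1
    have : volume (Ioo c d) = 0 := by
      refine measure_mono_null (fun t ht => ?_) h1
      exact fun himp => hd' t ht (himp (h0.trans_lt ht.1))
    simp only [Real.volume_Ioo, ENNReal.ofReal_eq_zero, tsub_le_iff_right, zero_add] at this
    exact absurd hd (not_lt.2 this)
  · rw [ae_restrict_iff' measurableSet_Ioi] at h2
    rw [ae_iff] at h2
    have : volume (Ioo (-(min d 0)) (-c)) = 0 := by
      refine measure_mono_null (fun t ht => ?_) h2
      have h3 : -t < min d 0 := by linarith [ht.1]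
      exact fun himp => hd' (-t) ⟨by linarith [ht.2], h3.trans_le (min_le_left _ _)⟩
        (himp (by simpa using h3.trans_le (min_le_right _ _)))
    simp only [Real.volume_Ioo, ENNReal.ofReal_eq_zero] at this
    have h4 : c < min d 0 := lt_min hd h0
    linarith

end StochasticOrder

/-! ### The extreme measure: membership, minimality, uniqueness. -/

section ExtremeMeasure

variable {Ω : Type*} [MeasurableSpace Ω] {P : Measure Ω} {X : Ω → ℝ}
  {ψ : ConcaveDistortion}

/-- The measure whose density is the derivative of `ψ` evaluated at `D_X(X)`. -/
def extremeMeasure (ψ : ConcaveDistortion) (P : Measure Ω) (X : Ω → ℝ) : Measure Ω :=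
  P.withDensity fun ω => ENNReal.ofReal (ψ.density (cdf (P.map X) (X ω)))

lemma measurable_extremeMeasure_density (hX : Measurable X) :
    Measurable fun ω => ENNReal.ofReal (ψ.density (cdf (P.map X) (X ω))) :=
  (ψ.measurable_density.comp (measurable_cdf_comp hX)).ennreal_ofReal

lemma lintegral_ofReal_neg_ne_top_of_bot_lt_extIntegral {α : Type*} [MeasurableSpace α]
    {f : α → ℝ} {ν : Measure α} (h : ⊥ < extIntegral f ν) :
    ∫⁻ a, ENNReal.ofReal (-f a) ∂ν ≠ ∞ := by
  intro htop
  rw [extIntegral, htop, EReal.coe_ennreal_top, EReal.sub_top] at h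
  exact lt_irrefl _ h

/-- When `X` has a continuous distribution, `distortedLaw ψ P X` is the law with the distribution
function `ψ ∘ D_X`. -/
lemma distortedLaw_Iic (hψ : Tendsto ψ (𝓝[>] 0) (𝓝 0)) (hc : Continuous (cdf (P.map X)))
    (c : ℝ) : distortedLaw ψ P X (Iic c) = ENNReal.ofReal (ψ (cdf (P.map X) c)) := by
  have hcont : Continuous fun x => ψ (cdf (P.map X) x) :=
    (ψ.continuousOn hψ).comp_continuous hc fun x => ⟨cdf_nonneg _ _, cdf_le_one _ _⟩
  have heq : ∀ x, (ψ.monotone_comp_cdf (P.map X)).stieltjesFunction x = ψ (cdf (P.map X) x) :=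
    fun x => by
      rw [Monotone.stieltjesFunction_eq]
      exact hcont.continuousAt.continuousWithinAt.rightLim_eq
  have hbot : Tendsto (ψ.monotone_comp_cdf (P.map X)).stieltjesFunction atBot (𝓝 0) := by
    simp only [funext heq]
    have h0 := (ψ.continuousOn hψ) 0 (left_mem_Icc.2 zero_le_one)
    rw [ContinuousWithinAt, ψ.map_zero] at h0
    exact h0.comp (tendsto_nhdsWithin_iff.2 ⟨tendsto_cdf_atBot _,
      Eventually.of_forall fun x => ⟨cdf_nonneg _ _, cdf_le_one _ _⟩⟩)
  rw [distortedLaw, StieltjesFunction.measure_Iic _ hbot, sub_zero, heq]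

variable [IsProbabilityMeasure P]

/-- Integrate `dQ/dP ≤ (dQ/dP - x)⁺ + x` over `A` with `x = ψ'(P(A))`, the slope at which the
conjugate is attained at `P(A)`. The values `P(A) = 0, 1` are separate because `density` is the
derivative only on the open interval. -/
lemma measureReal_le_of_mem_determiningSet {Q : Measure Ω} (hQ : Q ∈ determiningSet ψ P)
    (A : Set Ω) : Q.real A ≤ ψ (P.real A) := by
  obtain ⟨hprob, hac, hle⟩ := hQ
  have hpI : P.real A ∈ Icc (0 : ℝ) 1 := ⟨measureReal_nonneg, measureReal_le_one⟩
  rcases hpI.1.eq_or_lt with h0 | h0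
  · have : P A = 0 := (measureReal_eq_zero_iff (measure_ne_top _ _)).1 h0.symm
    simp [measureReal_def, hac this, this, ψ.map_zero]
  rcases hpI.2.eq_or_lt with h1 | h1
  · rw [h1, ψ.map_one]
    exact measureReal_le_one
  have hp : P.real A ∈ Ioo (0 : ℝ) 1 := ⟨h0, h1⟩
  set x := ψ.density (P.real A) with hx
  have hx0 : 0 ≤ x := ψ.density_nonneg _
  rw [measureReal_def]
  refine ENNReal.toReal_le_of_le_ofReal (ψ.nonneg hpI) ?_
  calc Q A = ∫⁻ ω in A, Q.rnDeriv P ω ∂P := (Measure.setLIntegral_rnDeriv hac A).symm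
    _ ≤ ∫⁻ ω in A, ((Q.rnDeriv P ω - ENNReal.ofReal x) + ENNReal.ofReal x) ∂P :=
        lintegral_mono fun ω => le_tsub_add
    _ = ∫⁻ ω in A, (Q.rnDeriv P ω - ENNReal.ofReal x) ∂P + ENNReal.ofReal x * P A := by
        rw [lintegral_add_right _ measurable_const, setLIntegral_const]
    _ ≤ ENNReal.ofReal (ψ.conj x) + ENNReal.ofReal x * ENNReal.ofReal (P.real A) := by
        rw [ofReal_measureReal]
        exact add_le_add ((setLIntegral_le_lintegral _ _).trans (hle x hx0)) le_rfl
    _ ≤ ENNReal.ofReal (ψ (P.real A) - x * P.real A) + ENNReal.ofReal (x * P.real A) := by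
        rw [ENNReal.ofReal_mul hx0]
        exact add_le_add (ENNReal.ofReal_le_ofReal (ψ.conj_density_le hp)) le_rfl
    _ = ENNReal.ofReal (ψ (P.real A)) := by
        have h := ψ.apply_le_density hp (left_mem_Icc.2 zero_le_one)
        rw [ψ.map_zero] at h
        rw [← ENNReal.ofReal_add (by linarith) (by positivity), sub_add_cancel]

lemma extremeMeasure_le (hψ : Tendsto ψ (𝓝[>] 0) (𝓝 0)) (hX : Measurable X)
    (hc : Continuous (cdf (P.map X))) (c : ℝ) :
    extremeMeasure ψ P X {ω | X ω ≤ c} = ENNReal.ofReal (ψ (cdf (P.map X) c)) := by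
  have hpI : cdf (P.map X) c ∈ Icc (0 : ℝ) 1 := ⟨cdf_nonneg _ _, cdf_le_one _ _⟩
  have hD := measurable_cdf_comp (μ := P.map X) hX
  have hm : MeasurableSet {ω | cdf (P.map X) (X ω) ≤ cdf (P.map X) c} :=
    measurableSet_le hD measurable_const
  have hac : extremeMeasure ψ P X ≪ P := withDensity_absolutelyContinuous _ _
  rw [measure_congr (hac.ae_eq (setOf_le_ae_eq_cdf_le hX hc c)), extremeMeasure,
    withDensity_apply _ hm]
  change ∫⁻ ω in (fun ω => cdf (P.map X) (X ω)) ⁻¹' Iic (cdf (P.map X) c), _ ∂P = _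
  rw [← setLIntegral_map (f := fun u => ENNReal.ofReal (ψ.density u)) measurableSet_Iic
    ψ.measurable_density.ennreal_ofReal hD, map_cdf_comp_eq hX hc,
    Measure.restrict_restrict measurableSet_Iic]
  have e : Iic (cdf (P.map X) c) ∩ Ioc 0 1 = Ioc 0 (cdf (P.map X) c) := by
    ext u
    exact ⟨fun h => ⟨h.2.1, h.1⟩, fun h => ⟨h.2, h.1, h.2.trans hpI.2⟩⟩
  rw [e, ψ.setLIntegral_density hψ hpI]

lemma isProbabilityMeasure_extremeMeasure (hψ : Tendsto ψ (𝓝[>] 0) (𝓝 0)) (hX : Measurable X)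
    (hc : Continuous (cdf (P.map X))) : IsProbabilityMeasure (extremeMeasure ψ P X) := by
  constructor
  rw [extremeMeasure, withDensity_apply _ MeasurableSet.univ, Measure.restrict_univ]
  rw [← lintegral_map (f := fun u => ENNReal.ofReal (ψ.density u))
    ψ.measurable_density.ennreal_ofReal (measurable_cdf_comp hX), map_cdf_comp_eq hX hc,
    ψ.setLIntegral_density hψ (right_mem_Icc.2 zero_le_one), ψ.map_one, ENNReal.ofReal_one]

lemma rnDeriv_extremeMeasure (hX : Measurable X) :
    (extremeMeasure ψ P X).rnDeriv P =ᵐ[P]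
      fun ω => ENNReal.ofReal (ψ.density (cdf (P.map X) (X ω))) :=
  Measure.rnDeriv_withDensity _ (measurable_extremeMeasure_density hX)

lemma extremeMeasure_mem_determiningSet (hψ : Tendsto ψ (𝓝[>] 0) (𝓝 0)) (hX : Measurable X)
    (hc : Continuous (cdf (P.map X))) : extremeMeasure ψ P X ∈ determiningSet ψ P := by
  refine ⟨isProbabilityMeasure_extremeMeasure hψ hX hc, withDensity_absolutelyContinuous _ _,
    fun x hx => ?_⟩
  calc ∫⁻ ω, ((extremeMeasure ψ P X).rnDeriv P ω - ENNReal.ofReal x) ∂P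
      = ∫⁻ ω, (ENNReal.ofReal (ψ.density (cdf (P.map X) (X ω))) - ENNReal.ofReal x) ∂P := by
        refine lintegral_congr_ae ?_
        filter_upwards [rnDeriv_extremeMeasure (ψ := ψ) (P := P) hX] with ω hω
        rw [hω]
    _ = ∫⁻ u in Ioo 0 1, (ENNReal.ofReal (ψ.density u) - ENNReal.ofReal x) := by
        rw [← lintegral_map (f := fun u => ENNReal.ofReal (ψ.density u) - ENNReal.ofReal x)
          (ψ.measurable_density.ennreal_ofReal.sub_const _) (measurable_cdf_comp hX),
          map_cdf_comp_eq hX hc, restrict_Ioo_eq_restrict_Ioc]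
    _ ≤ ENNReal.ofReal (ψ.conj x) := ψ.lintegral_density_sub_le hψ hx

lemma measure_le_le_extremeMeasure (hψ : Tendsto ψ (𝓝[>] 0) (𝓝 0)) (hX : Measurable X)
    (hc : Continuous (cdf (P.map X))) {Q : Measure Ω} (hQ : Q ∈ determiningSet ψ P) (c : ℝ) :
    Q {ω | X ω ≤ c} ≤ extremeMeasure ψ P X {ω | X ω ≤ c} := by
  have := hQ.1
  rw [extremeMeasure_le hψ hX hc, cdf_map_eq_real hX, ← ofReal_measureReal]
  exact ENNReal.ofReal_le_ofReal (measureReal_le_of_mem_determiningSet hQ _)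

lemma extremeMeasure_mem_extremeMeasures (hψ : Tendsto ψ (𝓝[>] 0) (𝓝 0)) (hX : Measurable X)
    (hc : Continuous (cdf (P.map X))) : extremeMeasure ψ P X ∈ extremeMeasures ψ P X := by
  refine ⟨extremeMeasure_mem_determiningSet hψ hX hc, fun Q hQ => ?_⟩
  have := hQ.1
  have := isProbabilityMeasure_extremeMeasure hψ hX hc
  exact extIntegral_le_of_measure_le_le hX fun c => measure_le_le_extremeMeasure hψ hX hc hQ c

/-- A measure of the determining set under which `X` has the distribution function `ψ ∘ D_X` has
density `ψ'(D_X(X))`. -/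
lemma rnDeriv_ae_eq_of_measure_le_eq (hX : Measurable X) (hc : Continuous (cdf (P.map X)))
    {Q : Measure Ω} (hQ : Q ∈ determiningSet ψ P)
    (hQc : ∀ c, Q.real {ω | X ω ≤ c} = ψ (cdf (P.map X) c)) :
    Q.rnDeriv P =ᵐ[P] fun ω => ENNReal.ofReal (ψ.density (cdf (P.map X) (X ω))) := by
  have := hQ.1
  have hle := measureReal_le_of_mem_determiningSet hQ
  have hm : ∀ c, MeasurableSet {ω | X ω ≤ c} := fun c => measurableSet_le hX measurable_const
  -- Remove `B` from the level set `A = {X ≤ c}`. From `Q(A) = ψ(P(A))`, `Q(A \ B) ≤ ψ(P(A) - P(B))`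
  -- and the supergradient inequality, `Q(B) ≥ ψ'(P(A)) P(B)`.
  have hlow : ∀ c, cdf (P.map X) c ∈ Ioo (0 : ℝ) 1 → ∀ᵐ ω ∂P, X ω ≤ c →
      ENNReal.ofReal (ψ.density (cdf (P.map X) c)) ≤ Q.rnDeriv P ω := by
    intro c hp
    refine (ae_restrict_iff' (hm c)).1 ?_
    refine ae_le_of_forall_setLIntegral_le_of_sigmaFinite measurable_const fun s hs _ => ?_
    rw [Measure.restrict_restrict hs, setLIntegral_const, Measure.setLIntegral_rnDeriv hQ.2.1]
    set B := s ∩ {ω | X ω ≤ c} with hB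
    have hBm : MeasurableSet B := hs.inter (hm c)
    have hBA : B ⊆ {ω | X ω ≤ c} := inter_subset_right
    rw [← ofReal_measureReal (μ := P), ← ofReal_measureReal (μ := Q),
      ← ENNReal.ofReal_mul (ψ.density_nonneg _)]
    refine ENNReal.ofReal_le_ofReal ?_
    have h1 := hle ({ω | X ω ≤ c} \ B)
    rw [measureReal_sdiff hBA hBm, measureReal_sdiff hBA hBm, hQc, ← cdf_map_eq_real hX] at h1
    have h2 : P.real B ≤ cdf (P.map X) c := by
      rw [cdf_map_eq_real hX]
      exact measureReal_mono hBA
    have h3 := ψ.apply_le_density hp (y := cdf (P.map X) c - P.real B)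
      ⟨by linarith, by linarith [hp.2, measureReal_nonneg (μ := P) (s := B)]⟩
    linarith
  -- The same perturbation with `B` added to the level set bounds the density from above.
  have hupp : ∀ c, cdf (P.map X) c ∈ Ioo (0 : ℝ) 1 → ∀ᵐ ω ∂P, ¬X ω ≤ c →
      Q.rnDeriv P ω ≤ ENNReal.ofReal (ψ.density (cdf (P.map X) c)) := by
    intro c hp
    refine (ae_restrict_iff' (hm c).compl).1 ?_
    refine ae_le_of_forall_setLIntegral_le_of_sigmaFinite (Measure.measurable_rnDeriv _ _)
      fun s hs _ => ?_
    rw [Measure.restrict_restrict hs, setLIntegral_const, Measure.setLIntegral_rnDeriv hQ.2.1]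
    set B := s ∩ {ω | X ω ≤ c}ᶜ with hB
    have hBm : MeasurableSet B := hs.inter (hm c).compl
    have hBA : Disjoint {ω | X ω ≤ c} B := disjoint_compl_right.mono_right inter_subset_right
    rw [← ofReal_measureReal (μ := P), ← ofReal_measureReal (μ := Q),
      ← ENNReal.ofReal_mul (ψ.density_nonneg _)]
    refine ENNReal.ofReal_le_ofReal ?_
    have h1 := hle ({ω | X ω ≤ c} ∪ B)
    have h2 : P.real ({ω | X ω ≤ c} ∪ B) ≤ 1 := measureReal_le_one
    rw [measureReal_union hBA hBm, ← cdf_map_eq_real hX] at h2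
    rw [measureReal_union hBA hBm, measureReal_union hBA hBm, hQc, ← cdf_map_eq_real hX] at h1
    have h3 := ψ.apply_le_density hp (y := cdf (P.map X) c + P.real B)
      ⟨by linarith [hp.1, measureReal_nonneg (μ := P) (s := B)], h2⟩
    linarith
  -- Rational levels keep the exceptional null sets countable. The value `0` outside `(0,1)` is a
  -- dummy.
  have hquant : ∀ p : ℚ, ∃ c, (p : ℝ) ∈ Ioo (0 : ℝ) 1 → cdf (P.map X) c = p := by
    intro p
    by_cases hp : (p : ℝ) ∈ Ioo (0 : ℝ) 1
    · exact (exists_cdf_eq hc hp).imp fun _ h _ => h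
    · exact ⟨0, fun h => absurd h hp⟩
  choose c hcp using hquant
  have hall : ∀ᵐ ω ∂P, ∀ p : ℚ, (p : ℝ) ∈ Ioo (0 : ℝ) 1 →
      (X ω ≤ c p → ENNReal.ofReal (ψ.density p) ≤ Q.rnDeriv P ω) ∧
      (¬X ω ≤ c p → Q.rnDeriv P ω ≤ ENNReal.ofReal (ψ.density p)) := by
    rw [ae_all_iff]
    intro p
    by_cases hp : (p : ℝ) ∈ Ioo (0 : ℝ) 1
    · have h1 := hlow (c p) (by rwa [hcp p hp])
      have h2 := hupp (c p) (by rwa [hcp p hp])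
      rw [hcp p hp] at h1 h2
      filter_upwards [h1, h2] with ω hω1 hω2 _
      exact ⟨hω1, hω2⟩
    · exact ae_of_all _ fun ω h => absurd h hp
  -- A monotone function has countably many discontinuities and `D(X)` is uniform, so the bounds at
  -- rational levels on either side of `D(X)` squeeze the density.
  have hcont : ∀ᵐ ω ∂P, ContinuousWithinAt ψ.density (Ioo 0 1) (cdf (P.map X) (X ω)) := by
    refine ae_of_ae_map (f := fun ω => cdf (P.map X) (X ω))
      (p := fun u => ContinuousWithinAt ψ.density (Ioo 0 1) u)
      (measurable_cdf_comp hX).aemeasurable ?_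
    rw [map_cdf_comp_eq hX hc, ← restrict_Ioo_eq_restrict_Ioc,
      ae_restrict_iff' measurableSet_Ioo, ae_iff]
    refine measure_mono_null (fun u hu => ?_)
      (ψ.antitoneOn_density.countable_not_continuousWithinAt.measure_zero volume)
    exact Classical.not_imp.1 hu
  filter_upwards [hall, hcont, ae_cdf_mem_Ioo hX hc] with ω hω hωc hωI
  set u := cdf (P.map X) (X ω) with hu
  have hcat : ContinuousAt ψ.density u := hωc.continuousAt (Ioo_mem_nhds hωI.1 hωI.2)
  have hcat' : ContinuousAt (fun v => ENNReal.ofReal (ψ.density v)) u :=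
    ENNReal.continuous_ofReal.continuousAt.comp hcat
  refine le_antisymm (le_of_forall_gt_imp_ge_of_dense fun a ha => ?_)
    (le_of_forall_lt_imp_le_of_dense fun a ha => ?_)
  · obtain ⟨l, hl, hl'⟩ := (mem_nhdsLT_iff_exists_Ioo_subset).1
      ((hcat'.eventually (gt_mem_nhds ha)).filter_mono nhdsWithin_le_nhds)
    obtain ⟨p, hp1, hp2⟩ := exists_rat_btwn (max_lt hl hωI.1)
    have hpI : (p : ℝ) ∈ Ioo (0 : ℝ) 1 := ⟨(le_max_right _ _).trans_lt hp1, hp2.trans hωI.2⟩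
    refine ((hω p hpI).2 fun hle => ?_).trans (le_of_lt (hl' ⟨(le_max_left _ _).trans_lt hp1, hp2⟩))
    have := monotone_cdf (P.map X) hle
    rw [hcp p hpI] at this
    exact absurd hp2 (not_lt.2 this)
  · obtain ⟨r, hr, hr'⟩ := (mem_nhdsGT_iff_exists_Ioo_subset).1
      ((hcat'.eventually (lt_mem_nhds ha)).filter_mono nhdsWithin_le_nhds)
    obtain ⟨p, hp1, hp2⟩ := exists_rat_btwn (lt_min hr hωI.2)
    have hpI : (p : ℝ) ∈ Ioo (0 : ℝ) 1 := ⟨hωI.1.trans hp1, hp2.trans_le (min_le_right _ _)⟩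
    refine (le_of_lt (hr' ⟨hp1, hp2.trans_le (min_le_left _ _)⟩)).trans ((hω p hpI).1 ?_)
    by_contra! h
    have := monotone_cdf (P.map X) h.le
    rw [hcp p hpI] at this
    exact absurd hp1 (not_lt.2 this)

/-- Carries the integrability condition in `IndexL1`, stated for the distorted law, over to the
extreme measure. -/
lemma map_extremeMeasure (hψ : Tendsto ψ (𝓝[>] 0) (𝓝 0)) (hX : Measurable X)
    (hc : Continuous (cdf (P.map X))) :
    (extremeMeasure ψ P X).map X = distortedLaw ψ P X := by
  have := isProbabilityMeasure_extremeMeasure hψ hX hc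
  refine Measure.ext_of_Iic _ _ fun c => ?_
  rw [distortedLaw_Iic hψ hc, Measure.map_apply hX measurableSet_Iic]
  exact extremeMeasure_le hψ hX hc c

lemma lintegral_ofReal_neg_extremeMeasure_ne_top (hψ : Tendsto ψ (𝓝[>] 0) (𝓝 0))
    (hX : Measurable X) (hc : Continuous (cdf (P.map X)))
    (h : ⊥ < distortedExpectation ψ P X) :
    ∫⁻ ω, ENNReal.ofReal (-X ω) ∂(extremeMeasure ψ P X) ≠ ∞ := by
  have := lintegral_ofReal_neg_ne_top_of_bot_lt_extIntegral h
  rwa [← map_extremeMeasure hψ hX hc, lintegral_map (by fun_prop) hX] at this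

/-- Positive parts are integrable under the extreme measure as soon as they are under `P`. -/
lemma lintegral_ofReal_extremeMeasure_le (hψ : Tendsto ψ (𝓝[>] 0) (𝓝 0))
    (hX : Measurable X) (hc : Continuous (cdf (P.map X))) :
    ∫⁻ ω, ENNReal.ofReal (X ω) ∂(extremeMeasure ψ P X) ≤ ∫⁻ ω, ENNReal.ofReal (X ω) ∂P := by
  have := isProbabilityMeasure_extremeMeasure hψ hX hc
  refine lintegral_ofReal_le_of_measure_le_le hX fun c => ?_
  rw [extremeMeasure_le hψ hX hc, measure_le_eq_cdf hX]
  exact ENNReal.ofReal_le_ofReal (ψ.le_apply ⟨cdf_nonneg _ _, cdf_le_one _ _⟩)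

/-- A second minimiser has the same mean, and the two integrability conditions make it finite.
Together with the stochastic order this identifies the law of `X`, and the law identifies the
density. -/
theorem extremeMeasures_eq_singleton (hψ : Tendsto ψ (𝓝[>] 0) (𝓝 0))
    (hX : Measurable X) (hc : Continuous (cdf (P.map X)))
    (hpos : ∫⁻ ω, ENNReal.ofReal (X ω) ∂P ≠ ∞) (h : ⊥ < distortedExpectation ψ P X) :
    extremeMeasures ψ P X = {extremeMeasure ψ P X} := by
  refine Subset.antisymm (fun Q hQ => ?_)
    (singleton_subset_iff.2 (extremeMeasure_mem_extremeMeasures hψ hX hc))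
  have := hQ.1.1
  have := isProbabilityMeasure_extremeMeasure hψ hX hc
  have heq := measure_le_eq_of_extIntegral_le hX
    (fun c => measure_le_le_extremeMeasure hψ hX hc hQ.1 c)
    (ne_top_of_le_ne_top hpos (lintegral_ofReal_extremeMeasure_le hψ hX hc))
    (lintegral_ofReal_neg_extremeMeasure_ne_top hψ hX hc h)
    (hQ.2 _ (extremeMeasure_mem_determiningSet hψ hX hc))
  have hrn := rnDeriv_ae_eq_of_measure_le_eq hX hc hQ.1 fun c => by
    rw [measureReal_def, heq, extremeMeasure_le hψ hX hc,
      ENNReal.toReal_ofReal (ψ.nonneg ⟨cdf_nonneg _ _, cdf_le_one _ _⟩)]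
  rw [mem_singleton_iff, ← Measure.withDensity_rnDeriv_eq Q P hQ.1.2.1]
  exact withDensity_congr_ae hrn

end ExtremeMeasure

/-! ### A random variable without atoms on an atomless space. -/

section Splitting

variable {Ω : Type*}

/-- The cells of a dyadic partition scheme: the cell of index `b :: l` is obtained by splitting the
cell of index `l` with the set that `f` assigns to it. -/
def splitCell (f : Set Ω → Set Ω) : List Bool → Set Ω
  | [] => univ
  | true :: l => f (splitCell f l)
  | false :: l => splitCell f l \ f (splitCell f l)

open Classical in
/-- The index of the cell of generation `n` to which a point belongs. -/
def splitIndex (f : Set Ω → Set Ω) : ℕ → Ω → List Bool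
  | 0, _ => []
  | n + 1, ω => decide (ω ∈ f (splitCell f (splitIndex f n ω))) :: splitIndex f n ω

lemma mem_splitCell_splitIndex (f : Set Ω → Set Ω) (n : ℕ) (ω : Ω) :
    ω ∈ splitCell f (splitIndex f n ω) := by
  induction n with
  | zero => simp [splitIndex, splitCell]
  | succ n ih =>
    by_cases h : ω ∈ f (splitCell f (splitIndex f n ω))
    · simp [splitIndex, splitCell, h]
    · simpa [splitIndex, splitCell, h] using ih

lemma length_splitIndex (f : Set Ω → Set Ω) (n : ℕ) (ω : Ω) : (splitIndex f n ω).length = n := by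
  induction n with
  | zero => rfl
  | succ n ih => simp [splitIndex, ih]

end Splitting

section Atomless

variable {Ω : Type*} [MeasurableSpace Ω] {P : Measure Ω} [IsProbabilityMeasure P]

lemma IsAtomlessMeasure.exists_subset_half (hP : IsAtomlessMeasure P) {A : Set Ω}
    (hA : MeasurableSet A) (h0 : 0 < P.real A) :
    ∃ B ⊆ A, MeasurableSet B ∧ 0 < P.real B ∧ P.real B ≤ P.real A / 2 := by
  obtain ⟨B, hBA, hB, hB0, hlt⟩ := hP A hA
    (pos_iff_ne_zero.2 fun h => h0.ne' ((measureReal_eq_zero_iff (measure_ne_top _ _)).2 h))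
  have hB0' : 0 < P.real B := ENNReal.toReal_pos hB0.ne' (measure_ne_top _ _)
  have hlt' : P.real B < P.real A :=
    (ENNReal.toReal_lt_toReal (measure_ne_top _ _) (measure_ne_top _ _)).2 hlt
  rcases le_total (P.real B) (P.real A / 2) with h | h
  · exact ⟨B, hBA, hB, hB0', h⟩
  · have hd := measureReal_sdiff (μ := P) hBA hB
    exact ⟨A \ B, sdiff_subset, hA.diff hB, by linarith, by linarith⟩

/-- If no such `B` existed, every subset of measure at most two thirds of `P(A)` would measure less
than one third, so these subsets would be closed under unions. Exhaustion then yields a largest one,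
which a small piece of its complement enlarges. Shrinking cells are all that is needed, so exact
halving is not sought. -/
lemma IsAtomlessMeasure.exists_subset_split (hP : IsAtomlessMeasure P) {A : Set Ω}
    (hA : MeasurableSet A) :
    ∃ B ⊆ A, MeasurableSet B ∧ P.real B ≤ 2 / 3 * P.real A ∧
      P.real (A \ B) ≤ 2 / 3 * P.real A := by
  rcases (measureReal_nonneg (μ := P) (s := A)).eq_or_lt with h0 | h0
  · exact ⟨∅, empty_subset _, MeasurableSet.empty, by simp, by simp [← h0]⟩
  by_contra! hcon
  let S : Set (Set Ω) := {B | B ⊆ A ∧ MeasurableSet B ∧ P.real B ≤ 2 / 3 * P.real A}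
  have hsmall : ∀ B ∈ S, P.real B < P.real A / 3 := fun B hB => by
    have h := hcon B hB.1 hB.2.1 hB.2.2
    rw [measureReal_sdiff hB.1 hB.2.1] at h
    linarith
  have hunion : ∀ B ∈ S, ∀ C ∈ S, B ∪ C ∈ S := fun B hB C hC =>
    ⟨union_subset hB.1 hC.1, hB.2.1.union hC.2.1, (measureReal_union_le B C).trans (by
      linarith [hsmall B hB, hsmall C hC])⟩
  have hempty : ∅ ∈ S := ⟨empty_subset _, MeasurableSet.empty, by simp⟩
  have hbdd : BddAbove (P.real '' S) :=
    ⟨1, by rintro _ ⟨B, _, rfl⟩; exact measureReal_le_one⟩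
  set s := sSup (P.real '' S) with hs
  have hne : (P.real '' S).Nonempty := ⟨_, ∅, hempty, rfl⟩
  obtain ⟨u, -, hu, huS⟩ := exists_seq_tendsto_sSup hne hbdd
  choose B hBS hBu using huS
  have hacc : ∀ n, Set.accumulate B n ∈ S := by
    intro n
    induction n with
    | zero => simpa using! hBS 0
    | succ n ih =>
      rw [accumulate_succ]
      exact hunion _ ih _ (hBS _)
  set M := ⋃ n, B n with hM
  have hMm : MeasurableSet M := MeasurableSet.iUnion fun n => (hBS n).2.1
  have hMS : M ∈ S := by
    refine ⟨iUnion_subset fun n => (hBS n).1, hMm, ?_⟩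
    have ht : Tendsto (fun n => P.real (Set.accumulate B n)) atTop (𝓝 (P.real M)) :=
      (ENNReal.tendsto_toReal (measure_ne_top _ _)).comp tendsto_measure_iUnion_accumulate
    exact le_of_tendsto' ht fun n => (hacc n).2.2
  have hsM : s ≤ P.real M := le_of_tendsto' hu fun n => by
    rw [← hBu n]
    exact measureReal_mono (subset_iUnion B n)
  have hdiff : P.real (A \ M) = P.real A - P.real M := measureReal_sdiff hMS.1 hMm
  have hM3 := hsmall M hMS
  obtain ⟨C, hCA, hC, hC0, -⟩ := hP.exists_subset_half (hA.diff hMm) (by linarith)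
  obtain ⟨C', hCC', hC', hC0', hC2'⟩ := hP.exists_subset_half hC hC0
  have hCle : P.real C ≤ P.real A := measureReal_mono (hCA.trans sdiff_subset)
  have hdisj : Disjoint M C' := by
    refine disjoint_left.2 fun ω h1 h2 => (hCA (hCC' h2)).2 h1
  have hun : P.real (M ∪ C') = P.real M + P.real C' := measureReal_union hdisj hC'
  have hC'A : C' ⊆ A := (hCC'.trans hCA).trans sdiff_subset
  have hC'S : C' ∈ S := ⟨hC'A, hC', by linarith⟩
  have := le_csSup hbdd ⟨_, hunion M hMS C' hC'S, rfl⟩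
  linarith

lemma measurableSet_splitCell {f : Set Ω → Set Ω}
    (hf : ∀ A, MeasurableSet A → MeasurableSet (f A)) (l : List Bool) :
    MeasurableSet (splitCell f l) := by
  induction l with
  | nil => exact MeasurableSet.univ
  | cons b l ih =>
    cases b
    · exact ih.diff (hf _ ih)
    · exact hf _ ih

lemma measurableSet_splitIndex_eq {f : Set Ω → Set Ω}
    (hf : ∀ A, MeasurableSet A → MeasurableSet (f A)) (n : ℕ) (l : List Bool) :
    MeasurableSet {ω | splitIndex f n ω = l} := by
  induction n generalizing l with
  | zero => simp [splitIndex]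
  | succ n ih =>
    cases l with
    | nil => simp [splitIndex]
    | cons b l =>
      have hm := hf _ (measurableSet_splitCell hf l)
      cases b
      · have e : {ω | splitIndex f (n + 1) ω = false :: l} =
            {ω | splitIndex f n ω = l} \ f (splitCell f l) := by
          ext ω
          simp only [splitIndex, List.cons.injEq, decide_eq_false_iff_not, mem_ofPred_eq,
            Set.mem_sdiff]
          constructor
          · rintro ⟨h1, rfl⟩; exact ⟨rfl, h1⟩
          · rintro ⟨rfl, h1⟩; exact ⟨h1, rfl⟩
        rw [e]
        exact (ih l).diff hm
      · have e : {ω | splitIndex f (n + 1) ω = true :: l} =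
            {ω | splitIndex f n ω = l} ∩ f (splitCell f l) := by
          ext ω
          simp only [splitIndex, List.cons.injEq, decide_eq_true_eq, mem_ofPred_eq, mem_inter_iff]
          constructor
          · rintro ⟨h1, rfl⟩; exact ⟨rfl, h1⟩
          · rintro ⟨rfl, h1⟩; exact ⟨h1, rfl⟩
        rw [e]
        exact (ih l).inter hm

lemma measureReal_splitCell_le {f : Set Ω → Set Ω}
    (hf : ∀ A, MeasurableSet A → MeasurableSet (f A))
    (hf' : ∀ A, MeasurableSet A → P.real (f A) ≤ 2 / 3 * P.real A ∧
      P.real (A \ f A) ≤ 2 / 3 * P.real A) (l : List Bool) :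
    P.real (splitCell f l) ≤ (2 / 3) ^ l.length := by
  induction l with
  | nil => simp [splitCell]
  | cons b l ih =>
    have h := hf' _ (measurableSet_splitCell hf l)
    rw [List.length_cons, pow_succ']
    cases b
    · exact h.2.trans (mul_le_mul_of_nonneg_left ih (by norm_num))
    · exact h.1.trans (mul_le_mul_of_nonneg_left ih (by norm_num))

/-- On an atomless probability space there is a bounded random variable whose distribution has no
atoms. -/
lemma IsAtomlessMeasure.exists_measurable_forall_measure_eq_zero (hP : IsAtomlessMeasure P) :
    ∃ X : Ω → ℝ, Measurable X ∧ (∀ ω, |X ω| ≤ 1) ∧ ∀ c, P {ω | X ω = c} = 0 := by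
  choose! f _ hfm hf1 hf2 using fun A (hA : MeasurableSet A) => hP.exists_subset_split hA
  -- `Y` records the whole path of a point through the partitions. An injective measurable map to
  -- `ℝ`, made bounded by the sigmoid, turns it into a random variable whose level sets lie in one
  -- cell of every generation, of measure at most `(2/3)^n`.
  let Y : Ω → ℕ → ℕ := fun ω n => Encodable.encode (splitIndex f n ω)
  have hY : Measurable Y := by
    refine measurable_pi_lambda _ fun n => measurable_to_countable' fun k => ?_
    have e : (fun ω => Y ω n) ⁻¹' {k} =
        ⋃ l ∈ {l : List Bool | Encodable.encode l = k}, {ω | splitIndex f n ω = l} := by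
      ext ω
      simp [Y]
    rw [e]
    exact MeasurableSet.biUnion (to_countable _) fun l _ => measurableSet_splitIndex_eq hfm n l
  have hemb := measurableEmbedding_sigmoid_comp_embeddingReal (ℕ → ℕ)
  refine ⟨fun ω => (unitInterval.sigmoid (embeddingReal (ℕ → ℕ) (Y ω)) : ℝ),
    measurable_subtype_coe.comp (hemb.measurable.comp hY),
    fun ω => ?_, fun c => ?_⟩
  · rw [abs_of_nonneg unitInterval.nonneg']
    exact unitInterval.le_one'
  · rcases
      {ω | (unitInterval.sigmoid (embeddingReal (ℕ → ℕ) (Y ω)) : ℝ) = c}.eq_empty_or_nonempty with h | ⟨ω₀, h⟩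
    · rw [h, measure_empty]
    have hsub : ∀ n, P.real {ω | (unitInterval.sigmoid (embeddingReal (ℕ → ℕ) (Y ω)) : ℝ) = c} ≤
        (2 / 3) ^ n := by
      intro n
      have := measureReal_splitCell_le (P := P) hfm (fun A hA => ⟨hf1 A hA, hf2 A hA⟩)
        (splitIndex f n ω₀)
      rw [length_splitIndex] at this
      refine (measureReal_mono fun ω hω => ?_).trans this
      have heq : Y ω = Y ω₀ := hemb.injective (Subtype.val_injective (Eq.trans hω (Eq.symm h)))
      have h2 : splitIndex f n ω = splitIndex f n ω₀ :=
        Encodable.encode_injective (congrFun heq n)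
      rw [← h2]
      exact mem_splitCell_splitIndex f n ω
    have hlim := ge_of_tendsto' (tendsto_pow_atTop_nhds_zero_of_lt_one
      (by norm_num : (0 : ℝ) ≤ 2 / 3) (by norm_num)) hsub
    exact (measureReal_eq_zero_iff (measure_ne_top _ _)).1 (le_antisymm hlim measureReal_nonneg)

lemma continuous_cdf_of_forall_measure_eq_zero {X : Ω → ℝ} (hX : Measurable X)
    (h : ∀ c, P {ω | X ω = c} = 0) : Continuous (cdf (P.map X)) := by
  have : IsProbabilityMeasure (P.map X) := Measure.isProbabilityMeasure_map hX.aemeasurable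
  rw [continuous_iff_continuousAt]
  intro c
  rw [(monotone_cdf _).continuousAt_iff_leftLim_eq_rightLim, StieltjesFunction.rightLim_eq]
  have h1 : (cdf (P.map X)).measure {c} = 0 := by
    rw [measure_cdf, Measure.map_apply hX (measurableSet_singleton c)]
    exact h c
  rw [StieltjesFunction.measure_singleton, ENNReal.ofReal_eq_zero] at h1
  exact le_antisymm ((monotone_cdf _).leftLim_le le_rfl) (by linarith)

lemma bot_lt_extIntegral_of_lintegral_ne_top {α : Type*} [MeasurableSpace α] {f : α → ℝ}
    {ν : Measure α} (h : ∫⁻ a, ENNReal.ofReal (-f a) ∂ν ≠ ∞) : ⊥ < extIntegral f ν := by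
  unfold extIntegral
  generalize ∫⁻ a, ENNReal.ofReal (-f a) ∂ν = b at *
  lift b to ℝ≥0 using h
  refine lt_of_lt_of_le (EReal.bot_lt_coe (-(b : ℝ))) ?_
  rw [EReal.coe_neg, sub_eq_add_neg, EReal.coe_nnreal_eq_coe_real]
  exact le_add_of_nonneg_left (EReal.coe_ennreal_nonneg _)

lemma bot_lt_distortedExpectation_of_bounded {ψ : ConcaveDistortion}
    (hψ : Tendsto ψ (𝓝[>] 0) (𝓝 0)) {X : Ω → ℝ} (hX : Measurable X)
    (hc : Continuous (cdf (P.map X))) (hb : ∀ ω, |X ω| ≤ 1) : ⊥ < distortedExpectation ψ P X := by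
  have := isProbabilityMeasure_extremeMeasure hψ hX hc
  refine bot_lt_extIntegral_of_lintegral_ne_top ?_
  rw [← map_extremeMeasure hψ hX hc, lintegral_map (by fun_prop) hX]
  refine ne_top_of_le_ne_top ENNReal.one_ne_top ?_
  calc ∫⁻ ω, ENNReal.ofReal (-X ω) ∂(extremeMeasure ψ P X)
      ≤ ∫⁻ _, 1 ∂(extremeMeasure ψ P X) := lintegral_mono fun ω => by
        rw [← ENNReal.ofReal_one]
        exact ENNReal.ofReal_le_ofReal ((neg_le_abs _).trans (hb ω))
    _ = 1 := by simp

/-- Keeps condition (a) from being vacuous. Boundedness puts `X` in `IndexL1` whatever the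
semigroup. -/
lemma IsAtomlessMeasure.exists_mem_IndexL1 (hP : IsAtomlessMeasure P)
    {Ψ : ℝ≥0 → ConcaveDistortion} (hzero : ∀ t, Tendsto (Ψ t) (𝓝[>] 0) (𝓝 0)) :
    ∃ X ∈ IndexL1 Ψ P, Continuous (cdf (P.map X)) := by
  obtain ⟨X, hX, hb, h0⟩ := hP.exists_measurable_forall_measure_eq_zero
  have hc := continuous_cdf_of_forall_measure_eq_zero hX h0
  have hc' : Continuous (cdf (P.map fun ω => -X ω)) :=
    continuous_cdf_of_forall_measure_eq_zero hX.neg fun c => by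
      simpa only [neg_eq_iff_eq_neg] using h0 (-c)
  exact ⟨X, ⟨hX, fun t => ⟨bot_lt_distortedExpectation_of_bounded (hzero t) hX hc hb,
    bot_lt_distortedExpectation_of_bounded (hzero t) hX.neg hc' fun ω => by
      rw [abs_neg]; exact hb ω⟩⟩, hc⟩

end Atomless

/-! ### Existence and concavity of the generator. -/

namespace ConcaveDistortion

variable (ψ : ConcaveDistortion)

lemma mul_apply_le_mul_apply {x y : ℝ} (hx : 0 ≤ x) (hxy : x ≤ y) (hy : y ≤ 1) :
    x * ψ y ≤ y * ψ x := by
  rcases (hx.trans hxy).eq_or_lt with h0 | h0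
  · obtain rfl : x = y := le_antisymm hxy (h0 ▸ hx)
    exact le_rfl
  have := ψ.concave.2 (left_mem_Icc.2 zero_le_one) (⟨h0.le, hy⟩ : y ∈ Icc (0 : ℝ) 1)
    (sub_nonneg.2 ((div_le_one h0).2 hxy)) (div_nonneg hx h0.le) (by ring)
  simp only [ψ.map_zero, smul_eq_mul, mul_zero, zero_add, div_mul_cancel₀ _ h0.ne'] at this
  rw [div_mul_eq_mul_div, div_le_iff₀ h0] at this
  linarith

lemma mul_apply_sub_le {x y : ℝ} (hx : 0 ≤ x) (hxy : x ≤ y) (hy : y ≤ 1) :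
    (1 - y) * (ψ x - x) ≤ (1 - x) * (ψ y - y) := by
  rcases hy.eq_or_lt with rfl | h
  · simp [ψ.map_one]
  · have := ψ.slope_one_antitone hx hxy h
    linarith

end ConcaveDistortion

namespace IsDistortionSemigroup

variable {Ψ : ℝ≥0 → ConcaveDistortion}

/-- `Ψ 0` is idempotent, and onto `[0,1]` by the intermediate value theorem, hence the identity. -/
lemma zero_apply (hΨ : IsDistortionSemigroup Ψ) (hzero : ∀ t, Tendsto (Ψ t) (𝓝[>] 0) (𝓝 0))
    {x : ℝ} (hx : x ∈ Icc (0 : ℝ) 1) : Ψ 0 x = x := by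
  obtain ⟨y, hy, rfl⟩ : x ∈ Ψ 0 '' Icc 0 1 := by
    have := intermediate_value_Icc (zero_le_one' ℝ) ((Ψ 0).continuousOn (hzero 0))
    rw [(Ψ 0).map_zero, (Ψ 0).map_one] at this
    exact this hx
  rw [hΨ.comp 0 0 y hy, add_zero]

/-- If `Ψ t x` stayed away from `x` for small `t`, then iterating would give `Ψ t z ≥ x` for all
`z > 0`. -/
lemma tendsto_time_zero (hΨ : IsDistortionSemigroup Ψ)
    (hzero : ∀ t, Tendsto (Ψ t) (𝓝[>] 0) (𝓝 0)) {x : ℝ} (hx : x ∈ Ioo (0 : ℝ) 1) :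
    Tendsto (fun t => Ψ t x) (𝓝[>] 0) (𝓝 x) := by
  have hxI : x ∈ Icc (0 : ℝ) 1 := ⟨hx.1.le, hx.2.le⟩
  rw [tendsto_order]
  refine ⟨fun a ha => Eventually.of_forall fun t => ha.trans_le ((Ψ t).le_apply hxI),
    fun y hy => ?_⟩
  by_contra hcon
  have hfar : ∀ t > 0, y ≤ Ψ t x := by
    intro t ht
    by_contra! h
    refine hcon ?_
    filter_upwards [Ioo_mem_nhdsGT ht] with s hs
    exact (hΨ.mono_time x hxI hs.2.le).trans_lt h
  -- Below `x` each application multiplies by at least `y / x > 1`, because `Ψ(z)/z` decreases.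
  -- Halving the time leaves room for any number of applications.
  have hiter : ∀ n : ℕ, ∀ t > 0, ∀ z, 0 < z → z ≤ x → min x ((y / x) ^ n * z) ≤ Ψ t z := by
    intro n
    induction n with
    | zero =>
      intro t _ z hz hzx
      rw [pow_zero, one_mul]
      exact (min_le_right _ _).trans ((Ψ t).le_apply ⟨hz.le, hzx.trans hxI.2⟩)
    | succ n ih =>
      intro t ht z hz hzx
      have hzI : z ∈ Icc (0 : ℝ) 1 := ⟨hz.le, hzx.trans hxI.2⟩
      have ht2 : 0 < t / 2 := half_pos ht
      have h1 : y / x * z ≤ Ψ (t / 2) z := by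
        have h2 := (Ψ (t / 2)).mul_apply_le_mul_apply hz.le hzx hxI.2
        rw [div_mul_eq_mul_div, div_le_iff₀ hx.1]
        nlinarith [hfar _ ht2]
      have hcomp : Ψ t z = Ψ (t / 2) (Ψ (t / 2) z) := by
        rw [hΨ.comp _ _ z hzI, add_halves]
      have hmem := (Ψ (t / 2)).mem_Icc hzI
      rw [hcomp]
      have hyx : 0 < y / x := div_pos (hx.1.trans hy) hx.1
      rcases le_total x (y / x * z) with h | h
      · exact (min_le_left _ _).trans (h.trans (h1.trans ((Ψ (t / 2)).le_apply hmem)))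
      · have h3 := ih (t / 2) ht2 (y / x * z) (by positivity) h
        rw [← mul_assoc, ← pow_succ] at h3
        exact h3.trans ((Ψ (t / 2)).mono ⟨by positivity, h.trans hxI.2⟩ hmem h1)
  have hbig : ∀ z, 0 < z → z ≤ x → x ≤ Ψ 1 z := by
    intro z hz hzx
    obtain ⟨n, hn⟩ := pow_unbounded_of_one_lt (x / z) ((one_lt_div hx.1).2 hy)
    have := hiter n 1 one_pos z hz hzx
    rwa [min_eq_left ((div_lt_iff₀ hz).1 hn).le] at this
  refine absurd (ge_of_tendsto (hzero 1) (b := x) ?_) (not_le.2 hx.1)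
  filter_upwards [Ioo_mem_nhdsGT hx.1] with z hz
  exact hbig z hz.1 hz.2.le

/-- Split the orbit into `n` steps of length `h`. At a point `v` of it with `x ≤ v ≤ Ψ s x`, the
increment `Ψ h v - v` is at least `(1 - v)/(1 - x)` times the first one, by the chord of `Ψ h - id`
to `1`. Sum the increments. -/
lemma nat_mul_sub_le (hΨ : IsDistortionSemigroup Ψ) {x : ℝ} (hx : x ∈ Icc (0 : ℝ) 1)
    (h s : ℝ≥0) (n : ℕ) (hn : n * h ≤ s) :
    n * ((Ψ h x - x) * (1 - Ψ s x)) ≤ (1 - x) * (Ψ s x - x) := by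
  have key : ∀ k : ℕ, k ≤ n →
      k * ((Ψ h x - x) * (1 - Ψ s x)) ≤ (1 - x) * (Ψ (k * h) x - x) := by
    intro k
    induction k with
    | zero =>
      intro _
      have := (Ψ ((0 : ℕ) * h)).le_apply hx
      simpa using mul_nonneg (sub_nonneg.2 hx.2) (sub_nonneg.2 this)
    | succ k ih =>
      intro hk
      have h1 := ih (by omega)
      have hmem := (Ψ (k * h)).mem_Icc hx
      have hcomp : Ψ ((k + 1 : ℕ) * h) x = Ψ h (Ψ (k * h) x) := by
        rw [hΨ.comp _ _ x hx]
        congr 2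
        push_cast
        ring
      have h2 := (Ψ h).mul_apply_sub_le hx.1 ((Ψ (k * h)).le_apply hx) hmem.2
      have h3 : Ψ (k * h) x ≤ Ψ s x := by
        refine hΨ.mono_time x hx (le_trans ?_ hn)
        gcongr
        omega
      have h4 : 0 ≤ Ψ h x - x := sub_nonneg.2 ((Ψ h).le_apply hx)
      rw [hcomp]
      push_cast
      nlinarith
  refine (key n le_rfl).trans ?_
  have := hΨ.mono_time x hx hn
  have h1 : 0 ≤ 1 - x := sub_nonneg.2 hx.2
  exact mul_le_mul_of_nonneg_left (sub_le_sub_right this x) h1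

lemma quotient_le (hΨ : IsDistortionSemigroup Ψ) {x : ℝ} (hx : x ∈ Icc (0 : ℝ) 1)
    {h s : ℝ≥0} (hh : 0 < h) :
    (Ψ h x - x) / h * (s - h) * (1 - Ψ s x) ≤ (1 - x) * (Ψ s x - x) := by
  have hh' : (0 : ℝ) < h := by exact_mod_cast hh
  have hfl : ⌊(s : ℝ) / h⌋₊ * h ≤ s := by
    have h1 := Nat.floor_le (div_nonneg s.coe_nonneg h.coe_nonneg)
    rw [le_div_iff₀ hh'] at h1
    exact_mod_cast h1
  have hfl' : (s : ℝ) - h ≤ ⌊(s : ℝ) / h⌋₊ * h := by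
    have h1 := Nat.lt_floor_add_one ((s : ℝ) / h)
    rw [div_lt_iff₀ hh'] at h1
    linarith
  refine le_trans ?_ (hΨ.nat_mul_sub_le hx h s _ hfl)
  have h4 : 0 ≤ Ψ h x - x := sub_nonneg.2 ((Ψ h).le_apply hx)
  have h5 : 0 ≤ 1 - Ψ s x := sub_nonneg.2 ((Ψ s).le_one hx)
  calc (Ψ h x - x) / h * (s - h) * (1 - Ψ s x)
      ≤ (Ψ h x - x) / h * (⌊(s : ℝ) / h⌋₊ * h) * (1 - Ψ s x) := by gcongr
    _ = _ := by field_simp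

lemma exists_tendsto_quotient (hΨ : IsDistortionSemigroup Ψ)
    (hzero : ∀ t, Tendsto (Ψ t) (𝓝[>] 0) (𝓝 0)) {x : ℝ} (hx : x ∈ Ioo (0 : ℝ) 1) :
    ∃ L, Tendsto (fun t : ℝ≥0 => (Ψ t x - x) / (t : ℝ)) (𝓝[>] 0) (𝓝 L) := by
  have hxI : x ∈ Icc (0 : ℝ) 1 := ⟨hx.1.le, hx.2.le⟩
  have hx1 : 0 < 1 - x := by linarith [hx.2]
  have htend := hΨ.tendsto_time_zero hzero hx
  set T : Set ℝ≥0 := {s | 0 < s ∧ Ψ s x < 1} with hT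
  have hTmem : ∀ᶠ s in 𝓝[>] 0, s ∈ T := by
    filter_upwards [self_mem_nhdsWithin, htend.eventually (gt_mem_nhds hx.2)] with s h1 h2
    exact ⟨h1, h2⟩
  -- The corrected quotient satisfies `(Ψ h x - x)/h ≤ C s * s/(s - h)` for `h < s`, and the
  -- correction factor tends to `1`; so the limit is the infimum of `C`.
  set C : ℝ≥0 → ℝ := fun s => (Ψ s x - x) / s * ((1 - x) / (1 - Ψ s x)) with hC
  have hTne : (C '' T).Nonempty := (hTmem.exists).elim fun s hs => ⟨_, s, hs, rfl⟩
  have hTbdd : BddBelow (C '' T) := by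
    refine ⟨0, ?_⟩
    rintro _ ⟨s, hs, rfl⟩
    have h4 : 0 ≤ Ψ s x - x := sub_nonneg.2 ((Ψ s).le_apply hxI)
    have h5 : 0 ≤ 1 - Ψ s x := sub_nonneg.2 hs.2.le
    positivity
  refine ⟨sInf (C '' T), tendsto_order.2 ⟨fun a ha => ?_, fun a ha => ?_⟩⟩
  · have hlim : Tendsto (fun s => sInf (C '' T) * ((1 - Ψ s x) / (1 - x))) (𝓝[>] 0)
        (𝓝 (sInf (C '' T))) := by
      have := ((tendsto_const_nhds (x := (1 : ℝ))).sub htend).div_const (1 - x)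
      rw [div_self hx1.ne'] at this
      simpa using this.const_mul (sInf (C '' T))
    filter_upwards [hTmem, hlim.eventually (lt_mem_nhds ha)] with s hs hsa
    refine hsa.trans_le ?_
    have h5 : 0 < 1 - Ψ s x := sub_pos.2 hs.2
    calc sInf (C '' T) * ((1 - Ψ s x) / (1 - x)) ≤ C s * ((1 - Ψ s x) / (1 - x)) := by
          gcongr
          exact csInf_le hTbdd ⟨s, hs, rfl⟩
      _ = _ := by simp only [hC]; field_simp
  · obtain ⟨_, ⟨s, hs, rfl⟩, hsa⟩ := exists_lt_of_csInf_lt hTne ha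
    have hs0 : (0 : ℝ) < s := by exact_mod_cast hs.1
    have h5 : 0 < 1 - Ψ s x := sub_pos.2 hs.2
    have hlim : Tendsto (fun h : ℝ≥0 => C s * (s / (s - h))) (𝓝[>] 0) (𝓝 (C s)) := by
      have h1 : Tendsto (fun h : ℝ≥0 => (s : ℝ) - h) (𝓝[>] 0) (𝓝 (s - (0 : ℝ≥0))) :=
        tendsto_nhdsWithin_of_tendsto_nhds
          (Continuous.tendsto (f := fun h : ℝ≥0 => (s : ℝ) - h) (by fun_prop) 0)
      rw [NNReal.coe_zero, sub_zero] at h1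
      have h2 := ((tendsto_const_nhds (x := (s : ℝ))).div h1 hs0.ne').const_mul (C s)
      rwa [div_self hs0.ne', mul_one] at h2
    filter_upwards [Ioo_mem_nhdsGT hs.1, hlim.eventually (gt_mem_nhds hsa)] with h hh hha
    refine lt_of_le_of_lt ?_ hha
    have hsh : (0 : ℝ) < s - h := sub_pos.2 (by exact_mod_cast hh.2)
    have := hΨ.quotient_le hxI (s := s) hh.1
    rw [mul_div_assoc', le_div_iff₀ hsh]
    simp only [hC]
    rw [show (Ψ s x - x) / s * ((1 - x) / (1 - Ψ s x)) * s =
      ((1 - x) * (Ψ s x - x)) / (1 - Ψ s x) by field_simp, le_div_iff₀ h5]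
    exact this

lemma tendsto_generator (hΨ : IsDistortionSemigroup Ψ)
    (hzero : ∀ t, Tendsto (Ψ t) (𝓝[>] 0) (𝓝 0)) {x : ℝ} (hx : x ∈ Ioo (0 : ℝ) 1) :
    Tendsto (fun t : ℝ≥0 => (Ψ t x - x) / (t : ℝ)) (𝓝[>] 0) (𝓝 (generator Ψ x)) := by
  rw [generator, if_pos hx]
  exact tendsto_nhds_limUnder (hΨ.exists_tendsto_quotient hzero hx)

end IsDistortionSemigroup

@[simp] lemma generator_one (Ψ : ℝ≥0 → ConcaveDistortion) : generator Ψ 1 = 0 := by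
  simp [generator]

namespace IsDistortionSemigroup

variable {Ψ : ℝ≥0 → ConcaveDistortion}

lemma generator_nonneg (hΨ : IsDistortionSemigroup Ψ)
    (hzero : ∀ t, Tendsto (Ψ t) (𝓝[>] 0) (𝓝 0)) {x : ℝ} (hx : x ∈ Ioo (0 : ℝ) 1) :
    0 ≤ generator Ψ x :=
  ge_of_tendsto' (hΨ.tendsto_generator hzero hx) fun t =>
    div_nonneg (sub_nonneg.2 ((Ψ t).le_apply ⟨hx.1.le, hx.2.le⟩)) t.coe_nonneg

lemma mul_generator_le (hΨ : IsDistortionSemigroup Ψ)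
    (hzero : ∀ t, Tendsto (Ψ t) (𝓝[>] 0) (𝓝 0)) {x y : ℝ} (hx : 0 < x) (hxy : x ≤ y)
    (hy : y < 1) : x * generator Ψ y ≤ y * generator Ψ x := by
  refine le_of_tendsto_of_tendsto'
    ((hΨ.tendsto_generator hzero ⟨hx.trans_le hxy, hy⟩).const_mul x)
    ((hΨ.tendsto_generator hzero ⟨hx, hxy.trans_lt hy⟩).const_mul y) fun t => ?_
  rw [mul_div_assoc', mul_div_assoc']
  refine div_le_div_of_nonneg_right ?_ t.coe_nonneg
  have := (Ψ t).mul_apply_le_mul_apply hx.le hxy hy.le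
  linarith

lemma one_sub_mul_generator_le (hΨ : IsDistortionSemigroup Ψ)
    (hzero : ∀ t, Tendsto (Ψ t) (𝓝[>] 0) (𝓝 0)) {x y : ℝ} (hx : 0 < x) (hxy : x ≤ y)
    (hy : y < 1) : (1 - y) * generator Ψ x ≤ (1 - x) * generator Ψ y := by
  refine le_of_tendsto_of_tendsto'
    ((hΨ.tendsto_generator hzero ⟨hx, hxy.trans_lt hy⟩).const_mul (1 - y))
    ((hΨ.tendsto_generator hzero ⟨hx.trans_le hxy, hy⟩).const_mul (1 - x)) fun t => ?_
  rw [mul_div_assoc', mul_div_assoc']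
  exact div_le_div_of_nonneg_right ((Ψ t).mul_apply_sub_le hx.le hxy hy.le) t.coe_nonneg

lemma continuousOn_generator (hΨ : IsDistortionSemigroup Ψ)
    (hzero : ∀ t, Tendsto (Ψ t) (𝓝[>] 0) (𝓝 0)) : ContinuousOn (generator Ψ) (Ioo 0 1) := by
  have hconc : ConcaveOn ℝ (Ioo 0 1) (generator Ψ) := by
    refine ⟨convex_Ioo _ _, fun x hx y hy a b ha hb hab => ?_⟩
    have hz := convex_Ioo (0 : ℝ) 1 hx hy ha hb hab
    refine le_of_tendsto_of_tendsto' (((hΨ.tendsto_generator hzero hx).const_mul a).add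
      ((hΨ.tendsto_generator hzero hy).const_mul b)) (hΨ.tendsto_generator hzero hz) fun t => ?_
    rw [mul_div_assoc', mul_div_assoc', ← add_div]
    refine div_le_div_of_nonneg_right ?_ t.coe_nonneg
    have := (Ψ t).concave.2 (Ioo_subset_Icc_self hx) (Ioo_subset_Icc_self hy) ha hb hab
    simp only [smul_eq_mul] at this ⊢
    linarith
  simpa [interior_Ioo] using hconc.continuousOn_interior

end IsDistortionSemigroup

/-! ### Orbits as solutions of `u' = G(u)`, and their behaviour near `1`. -/

/-- The orbit `s ↦ Ψ s x`, extended to negative times by its value at time `0`. -/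
def orbit (Ψ : ℝ≥0 → ConcaveDistortion) (x s : ℝ) : ℝ := Ψ s.toNNReal x

lemma tendsto_toNNReal_sub (s : ℝ) :
    Tendsto (fun r => (r - s).toNNReal) (𝓝[>] s) (𝓝[>] 0) := by
  refine tendsto_nhdsWithin_iff.2 ⟨?_, ?_⟩
  · have h1 : Tendsto (fun r => (r - s).toNNReal) (𝓝 s) (𝓝 (s - s).toNNReal) :=
      Continuous.tendsto (f := fun r => (r - s).toNNReal) (by fun_prop) s
    rw [sub_self, Real.toNNReal_zero] at h1
    exact tendsto_nhdsWithin_of_tendsto_nhds h1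
  · filter_upwards [self_mem_nhdsWithin] with r hr
    exact Real.toNNReal_pos.2 (sub_pos.2 hr)

namespace IsDistortionSemigroup

variable {Ψ : ℝ≥0 → ConcaveDistortion}

lemma orbit_zero (hΨ : IsDistortionSemigroup Ψ) (hzero : ∀ t, Tendsto (Ψ t) (𝓝[>] 0) (𝓝 0))
    {x : ℝ} (hx : x ∈ Icc (0 : ℝ) 1) : orbit Ψ x 0 = x := by
  rw [orbit, Real.toNNReal_zero, hΨ.zero_apply hzero hx]

lemma orbit_mono (hΨ : IsDistortionSemigroup Ψ) {x : ℝ} (hx : x ∈ Icc (0 : ℝ) 1) :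
    Monotone (orbit Ψ x) := fun _ _ h => hΨ.mono_time x hx (Real.toNNReal_mono h)

lemma orbit_eq (hΨ : IsDistortionSemigroup Ψ) {x : ℝ} (hx : x ∈ Icc (0 : ℝ) 1) {s r : ℝ}
    (hs : 0 ≤ s) (hsr : s ≤ r) : orbit Ψ x r = Ψ (r - s).toNNReal (orbit Ψ x s) := by
  rw [orbit, orbit, hΨ.comp _ _ x hx, ← Real.toNNReal_add (sub_nonneg.2 hsr) hs, sub_add_cancel]

lemma le_orbit (x s : ℝ) (hx : x ∈ Icc (0 : ℝ) 1) : x ≤ orbit Ψ x s := (Ψ _).le_apply hx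

lemma orbit_mem_Icc (x s : ℝ) (hx : x ∈ Icc (0 : ℝ) 1) : orbit Ψ x s ∈ Icc (0 : ℝ) 1 :=
  (Ψ _).mem_Icc hx

lemma continuousOn_orbit (hΨ : IsDistortionSemigroup Ψ)
    (hzero : ∀ t, Tendsto (Ψ t) (𝓝[>] 0) (𝓝 0)) {x : ℝ} (hx : x ∈ Ioo (0 : ℝ) 1) :
    ContinuousOn (orbit Ψ x) (Ici 0) := by
  have hxI : x ∈ Icc (0 : ℝ) 1 := ⟨hx.1.le, hx.2.le⟩
  -- Since `Ψ(u)/u` decreases and `u = Ψ s x ≥ x`, an increment starting at `u` is at most `u / x`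
  -- times the one starting at `x`. This gives a modulus of continuity uniform in `s`.
  have hmod : ∀ s r, 0 ≤ s → s ≤ r →
      |orbit Ψ x r - orbit Ψ x s| ≤ (Ψ |r - s|.toNNReal x - x) / x := by
    intro s r hs hsr
    rw [abs_of_nonneg (sub_nonneg.2 (hΨ.orbit_mono hxI hsr)), abs_of_nonneg (sub_nonneg.2 hsr),
      hΨ.orbit_eq hxI hs hsr, le_div_iff₀ hx.1]
    set u := orbit Ψ x s with hu
    have huI : u ∈ Icc (0 : ℝ) 1 := orbit_mem_Icc x s hxI
    have h1 := (Ψ (r - s).toNNReal).mul_apply_le_mul_apply hx.1.le (le_orbit x s hxI) huI.2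
    have h2 := (Ψ (r - s).toNNReal).le_apply hxI
    rw [← hu] at h1
    nlinarith [huI.2]
  have hcont : ContinuousAt (fun t => Ψ t x) 0 := by
    have h1 : ContinuousWithinAt (fun t => Ψ t x) (Ioi 0) 0 := by
      rw [ContinuousWithinAt, hΨ.zero_apply hzero hxI]
      exact hΨ.tendsto_time_zero hzero hx
    rw [continuousWithinAt_Ioi_iff_Ici, ← bot_eq_zero, Ici_bot, continuousWithinAt_univ] at h1
    exact h1
  intro s hs
  rw [ContinuousWithinAt, tendsto_iff_dist_tendsto_zero]
  have hlim : Tendsto (fun r => (Ψ |r - s|.toNNReal x - x) / x) (𝓝[Ici 0] s) (𝓝 0) := by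
    have h1 : Tendsto (fun r => |r - s|.toNNReal) (𝓝 s) (𝓝 |s - s|.toNNReal) :=
      Continuous.tendsto (f := fun r => |r - s|.toNNReal) (by fun_prop) s
    rw [sub_self, abs_zero, Real.toNNReal_zero] at h1
    have h2 := ((hcont.tendsto.comp h1).sub_const x).div_const x
    rw [hΨ.zero_apply hzero hxI, sub_self, zero_div] at h2
    exact tendsto_nhdsWithin_of_tendsto_nhds h2
  refine squeeze_zero' (Eventually.of_forall fun r => dist_nonneg) ?_ hlim
  filter_upwards [self_mem_nhdsWithin] with r hr
  rw [Real.dist_eq]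
  rcases le_total s r with h | h
  · exact hmod s r hs h
  · rw [abs_sub_comm, abs_sub_comm r s]
    exact hmod r s hr h

lemma hasDerivWithinAt_orbit (hΨ : IsDistortionSemigroup Ψ)
    (hzero : ∀ t, Tendsto (Ψ t) (𝓝[>] 0) (𝓝 0)) {x : ℝ} (hx : x ∈ Ioo (0 : ℝ) 1) {s : ℝ}
    (hs : 0 ≤ s) : HasDerivWithinAt (orbit Ψ x) (generator Ψ (orbit Ψ x s)) (Ici s) s := by
  have hxI : x ∈ Icc (0 : ℝ) 1 := ⟨hx.1.le, hx.2.le⟩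
  rw [← hasDerivWithinAt_Ioi_iff_Ici, hasDerivWithinAt_iff_tendsto_slope' (by simp)]
  have hslope : ∀ r ∈ Ioi s, slope (orbit Ψ x) s r =
      (Ψ (r - s).toNNReal (orbit Ψ x s) - orbit Ψ x s) / ((r - s).toNNReal : ℝ) := by
    intro r hr
    rw [slope_def_field, hΨ.orbit_eq hxI hs (le_of_lt hr),
      Real.coe_toNNReal _ (sub_nonneg.2 (le_of_lt hr))]
  refine Tendsto.congr' (eventually_nhdsWithin_of_forall fun r hr => (hslope r hr).symm) ?_
  have hu := orbit_mem_Icc (Ψ := Ψ) x s hxI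
  rcases hu.2.eq_or_lt with h1 | h1
  · rw [h1, generator_one]
    refine tendsto_const_nhds.congr fun r => ?_
    rw [(Ψ _).map_one, sub_self, zero_div]
  · exact (hΨ.tendsto_generator hzero ⟨hx.1.trans_le (le_orbit x s hxI), h1⟩).comp
      (tendsto_toNNReal_sub s)

/-- A nonnegative concave function with an interior zero vanishes on `(0,1)`. Then orbits are
constant and the semigroup is trivial. -/
lemma generator_pos (hΨ : IsDistortionSemigroup Ψ)
    (hzero : ∀ t, Tendsto (Ψ t) (𝓝[>] 0) (𝓝 0))
    (hne : ∃ t, ∃ x ∈ Icc (0 : ℝ) 1, Ψ t x ≠ x) {x : ℝ} (hx : x ∈ Ioo (0 : ℝ) 1) :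
    0 < generator Ψ x := by
  by_contra! hle
  have hvanish : ∀ y ∈ Ioc (0 : ℝ) 1, generator Ψ y = 0 := by
    intro y hy
    rcases hy.2.eq_or_lt with rfl | hy1
    · exact generator_one Ψ
    refine le_antisymm ?_ (hΨ.generator_nonneg hzero ⟨hy.1, hy1⟩)
    rcases le_total x y with h | h
    · have := hΨ.mul_generator_le hzero hx.1 h hy1
      by_contra! hpos
      nlinarith [mul_pos hx.1 hpos, hy.1]
    · have := hΨ.one_sub_mul_generator_le hzero hy.1 h hx.2
      by_contra! hpos
      nlinarith [mul_pos (sub_pos.2 hx.2) hpos, sub_pos.2 hy1]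
  obtain ⟨t, y, hy, hty⟩ := hne
  refine hty ?_
  rcases hy.1.eq_or_lt with rfl | h0
  · exact (Ψ t).map_zero
  rcases hy.2.eq_or_lt with rfl | h1
  · exact (Ψ t).map_one
  have h2 := constant_of_has_deriv_right_zero (f := orbit Ψ y) (a := 0) (b := t)
    ((hΨ.continuousOn_orbit hzero ⟨h0, h1⟩).mono Icc_subset_Ici_self) (fun s hs => by
      have h3 := hΨ.hasDerivWithinAt_orbit hzero ⟨h0, h1⟩ hs.1
      rwa [hvanish _ ⟨h0.trans_le (le_orbit y s hy), (orbit_mem_Icc y s hy).2⟩] at h3)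
    t ⟨t.coe_nonneg, le_rfl⟩
  rwa [hΨ.orbit_zero hzero hy, orbit, Real.toNNReal_coe] at h2

/-- Integrating factor for the comparison with `u' = K(1 - u)`: the sign of the derivative is that
of `K(1 - u) - G(u)`. -/
lemma hasDerivWithinAt_mul_exp (hΨ : IsDistortionSemigroup Ψ)
    (hzero : ∀ t, Tendsto (Ψ t) (𝓝[>] 0) (𝓝 0)) {y : ℝ} (hy : y ∈ Ioo (0 : ℝ) 1) (K : ℝ) {s : ℝ}
    (hs : 0 ≤ s) :
    HasDerivWithinAt (fun s => (1 - orbit Ψ y s) * Real.exp (K * s))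
      ((K * (1 - orbit Ψ y s) - generator Ψ (orbit Ψ y s)) * Real.exp (K * s)) (Ici s) s := by
  have h1 := ((hΨ.hasDerivWithinAt_orbit hzero hy hs).const_sub 1).mul
    (((hasDerivAt_id s).const_mul K).exp.hasDerivWithinAt (s := Ici s))
  convert! h1 using 1
  simp only [id, mul_one]
  ring

lemma continuousOn_mul_exp (hΨ : IsDistortionSemigroup Ψ)
    (hzero : ∀ t, Tendsto (Ψ t) (𝓝[>] 0) (𝓝 0)) {y : ℝ} (hy : y ∈ Ioo (0 : ℝ) 1) (K t : ℝ) :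
    ContinuousOn (fun s => (1 - orbit Ψ y s) * Real.exp (K * s)) (Icc 0 t) :=
  (continuousOn_const.sub ((hΨ.continuousOn_orbit hzero hy).mono Icc_subset_Ici_self)).mul
    (by fun_prop)

/-- A linear upper bound for the generator near `1` bounds the orbits away from `1`. -/
lemma one_sub_le_of_generator_le (hΨ : IsDistortionSemigroup Ψ)
    (hzero : ∀ t, Tendsto (Ψ t) (𝓝[>] 0) (𝓝 0)) {y K : ℝ} (hy : y ∈ Ioo (0 : ℝ) 1)
    (hK : ∀ z ∈ Ico y 1, generator Ψ z ≤ K * (1 - z)) (t : ℝ≥0) :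
    1 - y ≤ (1 - Ψ t y) * Real.exp (K * t) := by
  have hyI : y ∈ Icc (0 : ℝ) 1 := ⟨hy.1.le, hy.2.le⟩
  have h := image_le_of_deriv_right_le_deriv_boundary (a := 0) (b := t)
    (f := fun s => -((1 - orbit Ψ y s) * Real.exp (K * s))) (B := fun _ => -(1 - y))
    (B' := fun _ => 0) (hΨ.continuousOn_mul_exp hzero hy K t).neg
    (fun s hs => (hΨ.hasDerivWithinAt_mul_exp hzero hy K hs.1).neg)
    (by simp [hΨ.orbit_zero hzero hyI]) continuousOn_const
    (fun s _ => hasDerivWithinAt_const _ _ _) (fun s _ => ?_) (right_mem_Icc.2 t.coe_nonneg)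
  · simp only [orbit, Real.toNNReal_coe] at h
    linarith
  · rw [neg_nonpos]
    refine mul_nonneg (sub_nonneg.2 ?_) (Real.exp_nonneg _)
    rcases (orbit_mem_Icc (Ψ := Ψ) y s hyI).2.eq_or_lt with h1 | h1
    · simp [h1]
    · exact hK _ ⟨le_orbit y s hyI, h1⟩

/-- A linear lower bound for the generator near `1` attracts the orbits to `1`. -/
lemma one_sub_mul_exp_le_of_le_generator (hΨ : IsDistortionSemigroup Ψ)
    (hzero : ∀ t, Tendsto (Ψ t) (𝓝[>] 0) (𝓝 0)) {y K : ℝ} (hy : y ∈ Ioo (0 : ℝ) 1)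
    (hK : ∀ z ∈ Ico y 1, K * (1 - z) ≤ generator Ψ z) (t : ℝ≥0) :
    (1 - Ψ t y) * Real.exp (K * t) ≤ 1 - y := by
  have hyI : y ∈ Icc (0 : ℝ) 1 := ⟨hy.1.le, hy.2.le⟩
  have h := image_le_of_deriv_right_le_deriv_boundary (a := 0) (b := t)
    (f := fun s => (1 - orbit Ψ y s) * Real.exp (K * s)) (B := fun _ => 1 - y)
    (B' := fun _ => 0) (hΨ.continuousOn_mul_exp hzero hy K t)
    (fun s hs => hΨ.hasDerivWithinAt_mul_exp hzero hy K hs.1)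
    (by simp [hΨ.orbit_zero hzero hyI]) continuousOn_const
    (fun s _ => hasDerivWithinAt_const _ _ _) (fun s _ => ?_) (right_mem_Icc.2 t.coe_nonneg)
  · simpa only [orbit, Real.toNNReal_coe] using h
  · refine mul_nonpos_of_nonpos_of_nonneg (sub_nonpos.2 ?_) (Real.exp_nonneg _)
    rcases (orbit_mem_Icc (Ψ := Ψ) y s hyI).2.eq_or_lt with h1 | h1
    · simp [h1]
    · exact hK _ ⟨le_orbit y s hyI, h1⟩

/-- The time that an orbit needs to get from `y` to a point below `1` is the integral of the
reciprocal of the generator. -/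
lemma time_le_lintegral (hΨ : IsDistortionSemigroup Ψ)
    (hzero : ∀ t, Tendsto (Ψ t) (𝓝[>] 0) (𝓝 0))
    (hne : ∃ t, ∃ x ∈ Icc (0 : ℝ) 1, Ψ t x ≠ x) {y : ℝ} (hy : y ∈ Ioo (0 : ℝ) 1) {t : ℝ≥0}
    (ht : Ψ t y < 1) :
    (t : ℝ≥0∞) ≤ ∫⁻ s in Ioo y 1, (ENNReal.ofReal (generator Ψ s))⁻¹ := by
  have hyI : y ∈ Icc (0 : ℝ) 1 := ⟨hy.1.le, hy.2.le⟩
  have hG : ∀ z ∈ Ioo (0 : ℝ) 1, 0 < generator Ψ z := fun z hz => hΨ.generator_pos hzero hne hz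
  set F : ℝ → ℝ := fun z => (generator Ψ z)⁻¹ with hF
  have hFc : ContinuousOn F (Ioo 0 1) :=
    (hΨ.continuousOn_generator hzero).inv₀ fun z hz => (hG z hz).ne'
  have hFi : ∀ z ∈ Ico y 1, IntervalIntegrable F volume y z := fun z hz =>
    ContinuousOn.intervalIntegrable (hFc.mono (by
      rw [uIcc_of_le hz.1]
      exact fun w hw => ⟨hy.1.trans_le hw.1, hw.2.trans_lt hz.2⟩))
  have hH : ∀ z ∈ Ico y 1, HasDerivAt (fun z => ∫ w in y..z, F w) (F z) z := fun z hz => by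
    have hzI : z ∈ Ioo (0 : ℝ) 1 := ⟨hy.1.trans_le hz.1, hz.2⟩
    exact intervalIntegral.integral_hasDerivAt_right (hFi z hz)
      (hFc.stronglyMeasurableAtFilter isOpen_Ioo z hzI)
      (hFc.continuousAt (Ioo_mem_nhds hzI.1 hzI.2))
  have horb : ∀ s ∈ Icc (0 : ℝ) t, orbit Ψ y s ∈ Ico y 1 := fun s hs =>
    ⟨le_orbit y s hyI, ((hΨ.orbit_mono hyI hs.2).trans_lt (by
      rwa [orbit, Real.toNNReal_coe]))⟩
  -- With `H` an antiderivative of `1/G`, the function `H(Ψ_s(y)) - s` has zero right derivative.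
  have hconst := constant_of_has_deriv_right_zero (a := 0) (b := t)
    (f := fun s => (∫ w in y..orbit Ψ y s, F w) - s) (fun s hs =>
      ((hH _ (horb s hs)).continuousAt.comp_continuousWithinAt (f := orbit Ψ y)
        ((hΨ.continuousOn_orbit hzero hy).mono Icc_subset_Ici_self s hs)).sub
        continuousWithinAt_id)
    (fun s hs => by
      have h1 := horb s ⟨hs.1, hs.2.le⟩
      have h2 := ((hH _ h1).comp_hasDerivWithinAt s
        (hΨ.hasDerivWithinAt_orbit hzero hy hs.1)).sub (hasDerivWithinAt_id s (Ici s))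
      have h3 : F (orbit Ψ y s) * generator Ψ (orbit Ψ y s) - 1 = 0 := by
        rw [hF, inv_mul_cancel₀ (hG _ ⟨hy.1.trans_le h1.1, h1.2⟩).ne', sub_self]
      rw [h3] at h2
      exact h2)
    t ⟨t.coe_nonneg, le_rfl⟩
  simp only [hΨ.orbit_zero hzero hyI, intervalIntegral.integral_same, sub_zero] at hconst
  have hv : Ψ t y ∈ Ico y 1 := ⟨(Ψ t).le_apply hyI, ht⟩
  rw [orbit, Real.toNNReal_coe, sub_eq_zero, intervalIntegral.integral_of_le hv.1] at hconst
  have hFpos : ∀ᵐ w ∂volume.restrict (Ioc y (Ψ t y)), 0 ≤ F w := by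
    filter_upwards [ae_restrict_mem measurableSet_Ioc] with w hw
    exact (inv_pos.2 (hG w ⟨hy.1.trans hw.1, hw.2.trans_lt ht⟩)).le
  calc (t : ℝ≥0∞) = ENNReal.ofReal t := (ENNReal.ofReal_coe_nnreal).symm
    _ = ∫⁻ w in Ioc y (Ψ t y), ENNReal.ofReal (F w) := by
        rw [← hconst, ofReal_integral_eq_lintegral_ofReal (hFi _ hv).1 hFpos]
    _ = ∫⁻ w in Ioc y (Ψ t y), (ENNReal.ofReal (generator Ψ w))⁻¹ :=
        setLIntegral_congr_fun measurableSet_Ioc fun w hw =>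
          ENNReal.ofReal_inv_of_pos (hG w ⟨hy.1.trans hw.1, hw.2.trans_lt ht⟩)
    _ ≤ _ := lintegral_mono_set (Ioc_subset_Ioo_right ht)

lemma hasDerivWithinAt_zero_of_lintegral_lt_top (hΨ : IsDistortionSemigroup Ψ)
    (hzero : ∀ t, Tendsto (Ψ t) (𝓝[>] 0) (𝓝 0))
    (hne : ∃ t, ∃ x ∈ Icc (0 : ℝ) 1, Ψ t x ≠ x) {ε : ℝ} (hε : ε ∈ Ioo (0 : ℝ) 1)
    (hint : ∫⁻ s in Ioo (1 - ε) 1, (ENNReal.ofReal (generator Ψ s))⁻¹ < ⊤) {t : ℝ≥0}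
    (ht : 0 < t) : HasDerivWithinAt (Ψ t) 0 (Iic 1) 1 := by
  rw [ConcaveDistortion.hasDerivWithinAt_zero_iff]
  intro c hc
  have ht' : (t : ℝ≥0∞) ≠ 0 := by exact_mod_cast ht.ne'
  obtain ⟨δ, hδ, hδt⟩ := exists_pos_setLIntegral_lt_of_measure_lt hint.ne ht'
  obtain ⟨δ', hδ'0, hδ'⟩ := ENNReal.lt_iff_exists_nnreal_btwn.1 hδ
  have hδ'0 : (0 : ℝ) < δ' := by exact_mod_cast hδ'0
  set y : ℝ := max (1 - ε) (1 - δ') with hy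
  have hyI : y ∈ Ioo (0 : ℝ) 1 :=
    ⟨lt_max_of_lt_left (by linarith [hε.2]), max_lt (by linarith [hε.1]) (by linarith)⟩
  refine ⟨y, hyI, ?_⟩
  -- `y` is so close to `1` that the integral of `1/G` over `(y, 1)` is below `t`, which is too
  -- little time for the orbit to stay below `1`.
  have h1 : Ψ t y = 1 := by
    by_contra hcon
    have hlt := lt_of_le_of_ne ((Ψ t).le_one ⟨hyI.1.le, hyI.2.le⟩) hcon
    refine absurd (hδt (Ioo y 1) ?_) (not_lt.2 ?_)
    · refine (Measure.restrict_apply_le _ _).trans_lt (lt_of_le_of_lt ?_ hδ')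
      rw [Real.volume_Ioo, ← ENNReal.ofReal_coe_nnreal]
      exact ENNReal.ofReal_le_ofReal (by linarith [le_max_right (1 - ε) (1 - (δ' : ℝ))])
    · rw [Measure.restrict_restrict measurableSet_Ioo,
        inter_eq_left.2 (Ioo_subset_Ioo_left (le_max_left _ _))]
      exact hΨ.time_le_lintegral hzero hne hyI hlt
  rw [h1, sub_self]
  exact mul_pos hc (sub_pos.2 hyI.2)

lemma hasDerivWithinAt_zero_of_tendsto_atBot (hΨ : IsDistortionSemigroup Ψ)
    (hzero : ∀ t, Tendsto (Ψ t) (𝓝[>] 0) (𝓝 0))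
    (hbot : Tendsto (fun x => (generator Ψ x - generator Ψ 1) / (x - 1)) (𝓝[<] 1) atBot)
    {t : ℝ≥0} (ht : 0 < t) : HasDerivWithinAt (Ψ t) 0 (Iic 1) 1 := by
  rw [ConcaveDistortion.hasDerivWithinAt_zero_iff]
  intro c hc
  have ht' : (0 : ℝ) < t := by exact_mod_cast ht
  -- Chosen so that `c * exp (K * t) = e`.
  set K : ℝ := (1 - Real.log c) / t with hKdef
  have hexp : 1 < c * Real.exp (K * t) := by
    rw [hKdef, div_mul_cancel₀ _ ht'.ne', Real.exp_sub, Real.exp_log hc, mul_div_cancel₀ _ hc.ne']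
    exact Real.one_lt_exp_iff.2 one_pos
  obtain ⟨l, hl, hl'⟩ := (mem_nhdsLT_iff_exists_Ioo_subset).1 (hbot.eventually_le_atBot (-K))
  obtain ⟨y, hy1, hy2⟩ := exists_between (max_lt hl (zero_lt_one' ℝ))
  have hyI : y ∈ Ioo (0 : ℝ) 1 := ⟨(le_max_right _ _).trans_lt hy1, hy2⟩
  have h := hΨ.one_sub_mul_exp_le_of_le_generator hzero hyI (K := K) (fun z hz => by
    have h1 : (generator Ψ z - generator Ψ 1) / (z - 1) ≤ -K :=
      hl' ⟨((le_max_left _ _).trans_lt hy1).trans_le hz.1, hz.2⟩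
    rw [generator_one, sub_zero, div_le_iff_of_neg (sub_neg.2 hz.2)] at h1
    linarith) t
  refine ⟨y, hyI, ?_⟩
  have h1y : 0 < 1 - y := sub_pos.2 hyI.2
  by_contra! hcon
  have h2 := mul_le_mul_of_nonneg_right hcon (Real.exp_pos (K * t)).le
  nlinarith

lemma tendsto_atBot_of_hasDerivWithinAt_zero (hΨ : IsDistortionSemigroup Ψ)
    (hzero : ∀ t, Tendsto (Ψ t) (𝓝[>] 0) (𝓝 0)) {t : ℝ≥0}
    (hd : HasDerivWithinAt (Ψ t) 0 (Iic 1) 1) :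
    Tendsto (fun x => (generator Ψ x - generator Ψ 1) / (x - 1)) (𝓝[<] 1) atBot := by
  rw [ConcaveDistortion.hasDerivWithinAt_zero_iff] at hd
  rw [tendsto_atBot]
  intro b
  -- Otherwise `G(z) ≤ -b(1 - z)` everywhere, and the chord slopes of `Ψ t` to `1` stay above
  -- `e^{bt}`. One good `x` suffices, because `G(z)/(1 - z)` increases.
  obtain ⟨x, hx, hxb⟩ : ∃ x ∈ Ioo (0 : ℝ) 1, -b * (1 - x) < generator Ψ x := by
    by_contra! hcon
    obtain ⟨y, hy, hyc⟩ := hd (Real.exp (-(-b * t))) (Real.exp_pos _)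
    have h := hΨ.one_sub_le_of_generator_le hzero hy
      (fun z hz => hcon z ⟨hy.1.trans_le hz.1, hz.2⟩) t
    have h2 := mul_lt_mul_of_pos_right hyc (Real.exp_pos (-b * t))
    rw [mul_right_comm, ← Real.exp_add, neg_add_cancel, Real.exp_zero, one_mul] at h2
    linarith
  filter_upwards [Ioo_mem_nhdsLT hx.2] with z hz
  rw [generator_one, sub_zero, div_le_iff_of_neg (sub_neg.2 hz.2)]
  have h1 := hΨ.one_sub_mul_generator_le hzero hx.1 hz.1.le hz.2
  have hx1 : 0 < 1 - x := sub_pos.2 hx.2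
  have hz1 : 0 < 1 - z := sub_pos.2 hz.2
  by_contra! hcon
  nlinarith

end IsDistortionSemigroup

/-! ### Uniqueness on `IndexL1`, essential infimum, and the equivalences. -/

/-- At time `0` the distortion is the identity, so the condition on `-X` says that `X⁺` is
integrable. -/
lemma lintegral_ofReal_ne_top_of_mem_IndexL1 {Ω : Type*} [MeasurableSpace Ω] {P : Measure Ω}
    [IsProbabilityMeasure P] {Ψ : ℝ≥0 → ConcaveDistortion} (hΨ : IsDistortionSemigroup Ψ)
    (hzero : ∀ t, Tendsto (Ψ t) (𝓝[>] 0) (𝓝 0)) {X : Ω → ℝ} (hX : X ∈ IndexL1 Ψ P)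
    (hc : Continuous (cdf (P.map X))) : ∫⁻ ω, ENNReal.ofReal (X ω) ∂P ≠ ∞ := by
  have hm : Measurable fun ω => -X ω := hX.1.neg
  have hc' : Continuous (cdf (P.map fun ω => -X ω)) := by
    refine continuous_cdf_of_forall_measure_eq_zero hm fun c => ?_
    have : IsProbabilityMeasure (P.map X) := Measure.isProbabilityMeasure_map hX.1.aemeasurable
    have h1 : (cdf (P.map X)).measure {-c} = 0 := by
      rw [StieltjesFunction.measure_singleton, hc.continuousAt.continuousWithinAt.leftLim_eq,
        sub_self, ENNReal.ofReal_zero]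
    rw [measure_cdf, Measure.map_apply hX.1 (measurableSet_singleton _)] at h1
    simpa only [neg_eq_iff_eq_neg] using! h1
  have h := lintegral_ofReal_neg_ne_top_of_bot_lt_extIntegral (hX.2 0).2
  have hlaw : distortedLaw (Ψ 0) P (fun ω => -X ω) = P.map fun ω => -X ω := by
    have := isProbabilityMeasure_extremeMeasure (hzero 0) hm hc'
    have := Measure.isProbabilityMeasure_map (μ := P) hm.aemeasurable
    refine (Measure.ext_of_Iic _ _ fun c => ?_).symm
    rw [distortedLaw_Iic (hzero 0) hc',
      hΨ.zero_apply hzero ⟨cdf_nonneg _ _, cdf_le_one _ _⟩, ofReal_cdf]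
  rw [hlaw, lintegral_map (by fun_prop) hm] at h
  simpa only [neg_neg] using h

lemma extremeMeasures_eq_singleton_of_mem_IndexL1 {Ω : Type*} [MeasurableSpace Ω] {P : Measure Ω}
    [IsProbabilityMeasure P] {Ψ : ℝ≥0 → ConcaveDistortion} (hΨ : IsDistortionSemigroup Ψ)
    (hzero : ∀ t, Tendsto (Ψ t) (𝓝[>] 0) (𝓝 0)) {X : Ω → ℝ} (hX : X ∈ IndexL1 Ψ P)
    (hc : Continuous (cdf (P.map X))) (t : ℝ≥0) :
    extremeMeasures (Ψ t) P X = {extremeMeasure (Ψ t) P X} :=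
  extremeMeasures_eq_singleton (hzero t) hX.1 hc
    (lintegral_ofReal_ne_top_of_mem_IndexL1 hΨ hzero hX hc) (hX.2 t).1

/-- The density of the extreme measure has essential infimum `0` iff the left derivative of the
distortion at `1` vanishes. -/
lemma essInf_rnDeriv_extremeMeasure_eq_zero_iff {Ω : Type*} [MeasurableSpace Ω] {P : Measure Ω}
    [IsProbabilityMeasure P] {ψ : ConcaveDistortion} {X : Ω → ℝ} (hX : Measurable X)
    (hc : Continuous (cdf (P.map X))) :
    essInf ((extremeMeasure ψ P X).rnDeriv P) P = 0 ↔ HasDerivWithinAt ψ 0 (Iic 1) 1 := by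
  rw [essInf_congr_ae (rnDeriv_extremeMeasure hX), ψ.hasDerivWithinAt_zero_iff]
  constructor
  · intro h c hc0
    by_contra! hcon
    have hle : ENNReal.ofReal c ≤
        essInf (fun ω => ENNReal.ofReal (ψ.density (cdf (P.map X) (X ω)))) P := by
      refine le_essInf_of_ae_le _ ?_
      filter_upwards [ae_cdf_mem_Ioo hX hc] with ω hω
      refine ENNReal.ofReal_le_ofReal ?_
      have h1 := ψ.apply_le_density hω (right_mem_Icc.2 zero_le_one)
      rw [ψ.map_one] at h1
      have h2 := hcon _ hω
      exact le_of_mul_le_mul_right (by linarith) (sub_pos.2 hω.2)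
    rw [h] at hle
    exact absurd hle (not_le.2 (ENNReal.ofReal_pos.2 hc0))
  · intro h
    by_contra hne
    have hae := ae_essInf_le (μ := P)
      (f := fun ω => ENNReal.ofReal (ψ.density (cdf (P.map X) (X ω))))
    obtain ⟨m, hm0, hm⟩ := ENNReal.lt_iff_exists_nnreal_btwn.1 (pos_iff_ne_zero.2 hne)
    have hm0 : (0 : ℝ) < m := by exact_mod_cast hm0
    -- A density of at least `m` at some `u` beyond the midpoint of `[y, 1]` makes `ψ` grow by at
    -- least `m(1 - y)/2` from `y` to `u`. This exceeds `1 - ψ y`, contradicting `ψ u ≤ 1`.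
    obtain ⟨y, hy, hym⟩ := h (m / 2) (half_pos hm0)
    have hae' : ∀ᵐ u ∂(volume.restrict (Ioc (0 : ℝ) 1)), (m : ℝ) ≤ ψ.density u := by
      rw [← map_cdf_comp_eq hX hc]
      refine (ae_map_iff (measurable_cdf_comp hX).aemeasurable
        (measurableSet_le measurable_const ψ.measurable_density)).2 ?_
      filter_upwards [hae] with ω hω
      have h1 := hm.le.trans hω
      rwa [← ENNReal.ofReal_coe_nnreal, ENNReal.ofReal_le_ofReal_iff (ψ.density_nonneg _)] at h1
    rw [ae_restrict_iff' measurableSet_Ioc, ae_iff] at hae'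
    obtain ⟨u, hu, hmu⟩ : ∃ u ∈ Ioo ((y + 1) / 2) 1, (m : ℝ) ≤ ψ.density u := by
      by_contra! hcon
      have : volume (Ioo ((y + 1) / 2) 1) = 0 := by
        refine measure_mono_null (fun u hu => ?_) hae'
        exact fun himp => absurd (himp ⟨by linarith [hu.1, hy.1], hu.2.le⟩) (not_le.2 (hcon u hu))
      rw [Real.volume_Ioo, ENNReal.ofReal_eq_zero] at this
      linarith [hy.2]
    have huI : u ∈ Ioo (0 : ℝ) 1 := ⟨by linarith [hu.1, hy.1], hu.2⟩
    have h1 := ψ.apply_le_density huI (y := y) ⟨hy.1.le, hy.2.le⟩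
    have h2 := ψ.le_one (x := u) ⟨huI.1.le, huI.2.le⟩
    have h3 : (m : ℝ) * ((1 - y) / 2) ≤ ψ.density u * (u - y) :=
      mul_le_mul hmu (by linarith [hu.1]) (by linarith [hy.2]) (ψ.density_nonneg u)
    linarith

end

theorem corollary3 {Ω : Type*} [MeasurableSpace Ω] (P : Measure Ω) [IsProbabilityMeasure P]
    (hP : IsAtomlessMeasure P)
    (Ψ : ℝ≥0 → ConcaveDistortion) (hΨ : IsDistortionSemigroup Ψ)
    (hne : ∃ t, ∃ x ∈ Icc (0 : ℝ) 1, Ψ t x ≠ x)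
    (hzero : ∀ t, Tendsto (Ψ t) (𝓝[>] 0) (𝓝 0))
    (ε : ℝ) (hε : ε ∈ Ioo (0 : ℝ) 1) :
    (∀ x ∈ Ioo (0 : ℝ) 1,
      Tendsto (fun t : ℝ≥0 => (Ψ t x - x) / (t : ℝ)) (𝓝[>] 0) (𝓝 (generator Ψ x))) ∧
    (∀ X ∈ IndexL1 Ψ P, Continuous (cdf (P.map X)) →
      ∀ t, ∃ Q, extremeMeasures (Ψ t) P X = {Q}) ∧
    List.TFAE [
      ∀ X ∈ IndexL1 Ψ P, Continuous (cdf (P.map X)) →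
        ∀ t, 0 < t → ∀ Q ∈ extremeMeasures (Ψ t) P X, essInf (Q.rnDeriv P) P = 0,
      ∀ t, 0 < t → HasDerivWithinAt (Ψ t) 0 (Iic 1) 1,
      (∫⁻ s in Ioo (1 - ε) 1, (ENNReal.ofReal (generator Ψ s))⁻¹ < ⊤) ∨
        Tendsto (fun x => (generator Ψ x - generator Ψ 1) / (x - 1)) (𝓝[<] 1) atBot] := by
  have hsing : ∀ X ∈ IndexL1 Ψ P, Continuous (cdf (P.map X)) → ∀ t,
      extremeMeasures (Ψ t) P X = {extremeMeasure (Ψ t) P X} := fun X hX hc t =>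
    extremeMeasures_eq_singleton_of_mem_IndexL1 hΨ hzero hX hc t
  refine ⟨fun x hx => hΨ.tendsto_generator hzero hx, fun X hX hc t => ⟨_, hsing X hX hc t⟩, ?_⟩
  tfae_have 1 → 2 := by
    intro h t ht
    obtain ⟨X, hX, hc⟩ := hP.exists_mem_IndexL1 hzero
    exact (essInf_rnDeriv_extremeMeasure_eq_zero_iff hX.1 hc).1
      (h X hX hc t ht _ (hsing X hX hc t ▸ mem_singleton _))
  tfae_have 2 → 1 := by
    intro h X hX hc t ht Q hQ
    rw [hsing X hX hc t, mem_singleton_iff] at hQ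
    rw [hQ]
    exact (essInf_rnDeriv_extremeMeasure_eq_zero_iff hX.1 hc).2 (h t ht)
  -- Time `1` alone yields the derivative alternative. The integral condition thus implies it,
  -- through (b).
  tfae_have 2 → 3 := fun h =>
    Or.inr (hΨ.tendsto_atBot_of_hasDerivWithinAt_zero hzero (h 1 one_pos))
  tfae_have 3 → 2 := by
    rintro (h | h) t ht
    · exact hΨ.hasDerivWithinAt_zero_of_lintegral_lt_top hzero hne hε h ht
    · exact hΨ.hasDerivWithinAt_zero_of_tendsto_atBot hzero h ht
  tfae_finish
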